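/- Let $X$ be a compact Riemann surface with a smooth Riemannian metric in its conformal class, and let $E\to X$ be a smooth Hermitian complex vector bundle of finite rank. Let $A$ be a smooth unitary connection on $E$, with induced covariant derivative $d_A$ on forms with values in $\mathrm{End}(E)$ and connection Laplacian $\Delta_A=d_A^*d_A$, where $d_A^*=-\ast d_A\ast$ on $1$-forms. Let $\Phi\in\Omega^{1,0}(\mathfrak{sl}(E))$ be a smooth (not necessarily holomorphic) Higgs field, and let $t>0$. For a smooth section $\gamma\in\Omega^0(i\,\mathfrak{su}(E))$, i.e. a smooth Hermitian trace-free endomorphism of $E$, put $$M_\Phi\gamma=[\Phi^*\wedge[\Phi,\gamma]]-[\Phi\wedge[\Phi^*,\gamma]],\qquad L_t\gamma=\Delta_A\gamma-i\,t^2\ast M_\Phi\gamma .$$ Use the pointwise Hermitian inner product $\langle a,b\rangle=\mathrm{Tr}(ab^*)$ on $\mathrm{End}(E)$. For an $\mathrm{End}(E)$-valued $1$-form $\alpha$ let $\|\alpha\|^2_{L^2}=\int_X\sum_j|\alpha(e_j)|^2$, where $(e_1,e_2)$ is an orthonormal frame of the tangent space, and for a $(1,0)$-form let $\|\alpha\|^2_{1,0}=\int_X|\alpha(e)|^2$,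 where $e$ is any unit tangent vector (so $|dz|=1$ at a point where the metric is $|dz|^2$). All integrals are with respect to the Riemannian area. Then the functions $\langle L_t\gamma,\gamma\rangle$, $|d_A\gamma|^2$ and $|[\Phi,\gamma]|^2$ are integrable and $$t^{-2}\,\langle L_t\gamma,\gamma\rangle_{L^2}=t^{-2}\|d_A\gamma\|^2_{L^2}+4\,\|[\Phi,\gamma]\|^2_{1,0}\ \ge\ 0,$$ where $4\,\|[\Phi,\gamma]\|^2_{1,0}=2\,\|[\Phi,\gamma]\|^2_{L^2}$. In particular, $L_t\gamma=0$ on $X$ if and only if $d_A\gamma=0$ and $[\Phi,\gamma]=0$. -/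

import Mathlib

open Bundle MeasureTheory
open scoped Manifold ContDiff

attribute [local instance] InnerProductSpace.complexToReal

noncomputable section

namespace HiggsBundle

section RiemannSurface

variable {X : Type*} [TopologicalSpace X] [ChartedSpace ℂ X]

/-- A Riemann surface is in particular a smooth real surface. -/
instance isManifold_real [h : IsManifold 𝓘(ℂ) ω X] : IsManifold 𝓘(ℝ, ℂ) ∞ X := by
  refine isManifold_of_contDiffOn 𝓘(ℝ, ℂ) ∞ X fun e e' he he' => ?_
  have h1 : e.symm.trans e' ∈ contDiffGroupoid ω 𝓘(ℂ) :=
    HasGroupoid.compatible he he'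
  have h2 := ((contDiffGroupoid ω 𝓘(ℂ)).mem_iff_of_eqOnSource (Setoid.refl _)).1 h1
  rw [contDiffGroupoid, mem_groupoid_of_pregroupoid] at h2
  have h3 : ContDiffOn ℂ ω (𝓘(ℂ) ∘ e.symm.trans e' ∘ 𝓘(ℂ).symm)
    (𝓘(ℂ).symm ⁻¹' (e.symm.trans e').source ∩ Set.range 𝓘(ℂ)) := h2.1
  exact (h3.restrict_scalars ℝ).of_le le_top

/-- The complex structure `J` of the tangent spaces. The fibre `TangentSpace 𝓘(ℝ, ℂ) x` is `ℂ`,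
through the chart of the atlas preferred at `x`; as coordinate changes are holomorphic,
multiplication by `i` does not depend on that chart. -/
def tangentJ (x : X) : TangentSpace 𝓘(ℝ, ℂ) x →L[ℝ] TangentSpace 𝓘(ℝ, ℂ) x :=
  (ContinuousLinearMap.mul ℝ ℂ Complex.I : ℂ →L[ℝ] ℂ)

/-- The coordinate vector `∂/∂x` at the point `x`, in the chart of the atlas preferred at `x`. -/
def tangentOne (x : X) : TangentSpace 𝓘(ℝ, ℂ) x := (1 : ℂ)

variable (X) in
/-- A smooth Riemannian metric in the conformal class of the Riemann surface `X`. -/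
structure ConformalMetric [IsManifold 𝓘(ℂ) ω X] extends
    ContMDiffRiemannianMetric 𝓘(ℝ, ℂ) ∞ ℂ (TangentSpace 𝓘(ℝ, ℂ) : X → Type _) where
  inner_J (x : X) (v w : TangentSpace 𝓘(ℝ, ℂ) x) :
    inner x (tangentJ x v) (tangentJ x w) = inner x v w

namespace ConformalMetric

variable [IsManifold 𝓘(ℂ) ω X] (g : ConformalMetric X)

/-- The factor `ρ` in the expression `ρ |dz|²` of the metric in a chart `z`: it is
`g(∂/∂x, ∂/∂x)`, as a function of the coordinate. As `g` is conformal, the Riemannian area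
form is `ρ dx ∧ dy`. -/
def density (e : OpenPartialHomeomorph X ℂ) (z : ℂ) : ℝ :=
  let v : TangentSpace 𝓘(ℝ, ℂ) (e.symm z) := mfderiv 𝓘(ℝ, ℂ) 𝓘(ℝ, ℂ) e.symm z (1 : ℂ)
  g.inner (e.symm z) v v

/-- The Riemannian area measure: the measure which is `ρ dx dy` in each chart of the atlas, namely
the least measure which dominates all these local measures. -/
def area [MeasurableSpace X] : Measure X :=
  ⨆ e ∈ atlas ℂ X, Measure.map e.symm
    ((volume.restrict e.target).withDensity fun z => ENNReal.ofReal (g.density e z))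

end ConformalMetric

end RiemannSurface

section LinearAlgebra

variable {V : Type*} [NormedAddCommGroup V] [InnerProductSpace ℂ V] [FiniteDimensional ℂ V]

/-- The adjoint of an endomorphism of a finite dimensional Hermitian vector space. -/
def endAdjoint (a : V →L[ℂ] V) : V →L[ℂ] V :=
  LinearMap.toContinuousLinearMap (LinearMap.adjoint (a : V →ₗ[ℂ] V))

/-- The trace of an endomorphism. -/
def endTrace (a : V →L[ℂ] V) : ℂ := LinearMap.trace ℂ V (a : V →ₗ[ℂ] V)

/-- The Hermitian inner product `⟨a, b⟩ = Tr (a b*)` on endomorphisms. -/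
def endInner (a b : V →L[ℂ] V) : ℂ := endTrace (a * endAdjoint b)

/-- The square norm `|a|² = Tr (a a*)` of an endomorphism. -/
def endNormSq (a : V →L[ℂ] V) : ℝ := (endInner a a).re

end LinearAlgebra

section Bundles

variable {X : Type*} [TopologicalSpace X] [ChartedSpace ℂ X] [IsManifold 𝓘(ℂ) ω X]
  (F : Type*) [NormedAddCommGroup F] [NormedSpace ℂ F]
  {E : X → Type*} [TopologicalSpace (TotalSpace F E)]
  [∀ x, NormedAddCommGroup (E x)] [∀ x, InnerProductSpace ℂ (E x)]
  [FiberBundle F E]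

/-- The section `x ↦ γ x` of the bundle `Hom(E, E)`, as a map to its total space. -/
def endSection (γ : ∀ x, E x →L[ℂ] E x) (x : X) :
    TotalSpace (F →L[ℝ] F) (fun x => E x →L[ℝ] E x) :=
  TotalSpace.mk' (F →L[ℝ] F) x ((γ x).restrictScalars ℝ)

/-- The `1`-form `α` with values in `Hom(E, E)`, as a map to the total space of the bundle
`Hom(TX, Hom(E, E))`. -/
def endOneFormSection (α : ∀ x : X, TangentSpace 𝓘(ℝ, ℂ) x →L[ℝ] (E x →L[ℂ] E x)) (x : X) :
    TotalSpace (ℂ →L[ℝ] F →L[ℝ] F)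
      (fun x : X => TangentSpace 𝓘(ℝ, ℂ) x →L[ℝ] (E x →L[ℝ] E x)) :=
  TotalSpace.mk' (ℂ →L[ℝ] F →L[ℝ] F) x
    ((ContinuousLinearMap.restrictScalarsL ℂ (E x) (E x) ℝ ℝ).comp (α x))

variable [VectorBundle ℂ F E] [VectorBundle ℝ F E]

/-- The section `γ` belongs to `Ω⁰(i su(E))`: it is smooth, and all its values are Hermitian and
trace-free. -/
structure IsHermitianSection (γ : ∀ x, E x →L[ℂ] E x) : Prop where
  smooth : ContMDiff 𝓘(ℝ, ℂ) (𝓘(ℝ, ℂ).prod 𝓘(ℝ, F →L[ℝ] F)) ∞ (endSection F γ)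
  hermitian : ∀ x, (γ x : E x →ₗ[ℂ] E x).IsSymmetric
  traceFree : ∀ x, endTrace (γ x) = 0

/-- A Higgs field `Φ` (not assumed to be holomorphic): a smooth form of type `(1, 0)` with values
in the trace-free endomorphisms of `E`. -/
structure IsHiggsField (Φ : ∀ x : X, TangentSpace 𝓘(ℝ, ℂ) x →L[ℝ] (E x →L[ℂ] E x)) : Prop where
  smooth : ContMDiff 𝓘(ℝ, ℂ) (𝓘(ℝ, ℂ).prod 𝓘(ℝ, ℂ →L[ℝ] F →L[ℝ] F)) ∞ (endOneFormSection F Φ)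
  type_one_zero : ∀ x v, Φ x (tangentJ x v) = Complex.I • Φ x v
  traceFree : ∀ x v, endTrace (Φ x v) = 0

variable (E) [FiniteDimensional ℂ F] [ContMDiffVectorBundle ∞ F E 𝓘(ℝ, ℂ)]
  [IsContMDiffRiemannianBundle 𝓘(ℝ, ℂ) ∞ F E]

/-- A smooth unitary connection on the Hermitian vector bundle `E`: a smooth connection which is
complex linear and compatible with the real part of the Hermitian metric, hence with the Hermitian
metric. -/
structure UnitaryConnection extends CovariantDerivative 𝓘(ℝ, ℂ) F E where
  smooth : CovariantDerivative.ContMDiffCovariantDerivative toCovariantDerivative ∞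
  map_I_smul : ∀ (σ : ∀ x, E x) (x : X),
    MDifferentiableAt 𝓘(ℝ, ℂ) (𝓘(ℝ, ℂ).prod 𝓘(ℝ, F)) (fun y => TotalSpace.mk' F y (σ y)) x →
    ∀ v, toFun (fun y => Complex.I • σ y) x v = Complex.I • toFun σ x v
  isMetricCompatible : toCovariantDerivative.IsMetricCompatible

set_option linter.unusedSectionVars false

namespace UnitaryConnection

variable {F E}
variable (A : UnitaryConnection F E)

/-- The operation which defines the induced connection on `Hom(E, E)`, for a tangent vector `v` at
the point `x`: it sends a section `σ` of `E` to `∇_v (γ σ) - γ (∇_v σ)`. -/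
def endCovAux (γ : ∀ x, E x →L[ℂ] E x) (x : X) (v : TangentSpace 𝓘(ℝ, ℂ) x) (σ : ∀ x, E x) : E x :=
  A.toFun (fun y => γ y (σ y)) x v - γ x (A.toFun σ x v)

theorem mdifferentiableAt_end_apply {γ : ∀ x, E x →L[ℂ] E x} {x : X}
    (hγ : MDifferentiableAt 𝓘(ℝ, ℂ) (𝓘(ℝ, ℂ).prod 𝓘(ℝ, F →L[ℝ] F)) (endSection F γ) x)
    {σ : ∀ x, E x}
    (hσ : MDifferentiableAt 𝓘(ℝ, ℂ) (𝓘(ℝ, ℂ).prod 𝓘(ℝ, F)) (fun y => TotalSpace.mk' F y (σ y)) x) :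
    MDifferentiableAt 𝓘(ℝ, ℂ) (𝓘(ℝ, ℂ).prod 𝓘(ℝ, F))
      (fun y => TotalSpace.mk' F y (γ y (σ y))) x :=
  MDifferentiableAt.clm_bundle_apply (F₁ := F) (F₂ := F) (b := fun y => y) (x := x)
    (ϕ := fun y => (γ y).restrictScalars ℝ) (v := σ) hγ hσ

theorem tensorialAt_endCovAux {γ : ∀ x, E x →L[ℂ] E x} {x : X}
    (hγ : MDifferentiableAt 𝓘(ℝ, ℂ) (𝓘(ℝ, ℂ).prod 𝓘(ℝ, F →L[ℝ] F)) (endSection F γ) x)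
    (v : TangentSpace 𝓘(ℝ, ℂ) x) : TensorialAt 𝓘(ℝ, ℂ) F (A.endCovAux γ x v) x where
  smul {f σ} hf hσ := by
    have h1 := A.isCovariantDerivativeOnUniv.leibniz hσ hf
    have h2 := A.isCovariantDerivativeOnUniv.leibniz (mdifferentiableAt_end_apply hγ hσ) hf
    have h3 : (fun y => γ y ((f • σ) y)) = f • (fun y => γ y (σ y)) := by
      funext y
      exact ((γ y).restrictScalars ℝ).map_smul (f y) (σ y)
    have h4 (r : ℝ) (w : E x) : γ x (r • w) = r • γ x w :=
      ((γ x).restrictScalars ℝ).map_smul r w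
    unfold endCovAux
    rw [h3, h2, h1]
    simp only [add_apply, smul_apply,
      ContinuousLinearMap.smulRight_apply, map_add, h4, smul_sub]
    abel
  add {σ σ'} hσ hσ' := by
    have h1 := A.isCovariantDerivativeOnUniv.add hσ hσ'
    have h2 := A.isCovariantDerivativeOnUniv.add (mdifferentiableAt_end_apply hγ hσ)
      (mdifferentiableAt_end_apply hγ hσ')
    have h3 : (fun y => γ y ((σ + σ') y)) = (fun y => γ y (σ y)) + (fun y => γ y (σ' y)) := by
      funext y
      exact map_add (γ y) (σ y) (σ' y)
    unfold endCovAux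
    rw [h3, h2, h1]
    simp only [add_apply, map_add]
    abel

theorem endCovAux_I_smul {γ : ∀ x, E x →L[ℂ] E x} {x : X}
    (hγ : MDifferentiableAt 𝓘(ℝ, ℂ) (𝓘(ℝ, ℂ).prod 𝓘(ℝ, F →L[ℝ] F)) (endSection F γ) x)
    (v : TangentSpace 𝓘(ℝ, ℂ) x) {σ : ∀ x, E x}
    (hσ : MDifferentiableAt 𝓘(ℝ, ℂ) (𝓘(ℝ, ℂ).prod 𝓘(ℝ, F)) (fun y => TotalSpace.mk' F y (σ y)) x) :
    A.endCovAux γ x v (fun y => Complex.I • σ y) = Complex.I • A.endCovAux γ x v σ := by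
  have h3 : (fun y => γ y (Complex.I • σ y)) = fun y => Complex.I • γ y (σ y) := by
    funext y
    exact map_smul (γ y) Complex.I (σ y)
  unfold endCovAux
  rw [h3, A.map_I_smul _ _ (mdifferentiableAt_end_apply hγ hσ), A.map_I_smul _ _ hσ, map_smul,
    smul_sub]

theorem mdifferentiableAt_I_smul_extend {x : X} (e : E x) :
    MDifferentiableAt 𝓘(ℝ, ℂ) (𝓘(ℝ, ℂ).prod 𝓘(ℝ, F))
      (fun y => TotalSpace.mk' F y (Complex.I • FiberBundle.extend F e y)) x := by
  have hd : MDifferentiableAt 𝓘(ℝ, ℂ) (𝓘(ℝ, ℂ).prod 𝓘(ℝ, F))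
      (fun y => TotalSpace.mk' F y (FiberBundle.extend F (Complex.I • e) y)) x :=
    FiberBundle.mdifferentiableAt_extend ..
  refine hd.congr_of_eventuallyEq ?_
  filter_upwards [(trivializationAt F E x).open_baseSet.mem_nhds
    (FiberBundle.mem_baseSet_trivializationAt' x)] with y hy
  have h1 : (trivializationAt F E x ⟨x, Complex.I • e⟩).2
      = Complex.I • (trivializationAt F E x ⟨x, e⟩).2 :=
    ((trivializationAt F E x).linear ℂ (FiberBundle.mem_baseSet_trivializationAt' x)).map_smul _ _
  have h2 := ((trivializationAt F E x).symmₗ ℂ y).map_smul Complex.I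
    (trivializationAt F E x ⟨x, e⟩).2
  rw [Trivialization.symmₗ_apply (R := ℂ) _ hy, Trivialization.symmₗ_apply (R := ℂ) _ hy] at h2
  have h3 : FiberBundle.extend F (Complex.I • e) y =
      (trivializationAt F E x).symm y (trivializationAt F E x ⟨x, Complex.I • e⟩).2 := rfl
  have h4 : FiberBundle.extend F e y =
      (trivializationAt F E x).symm y (trivializationAt F E x ⟨x, e⟩).2 := rfl
  rw [h3, h1, h4, h2]

/-- The value `∇_v γ` of the connection induced on `Hom(E, E)`, for a section `γ` which is
differentiable at `x`. -/
def endCovOfDifferentiable {γ : ∀ x, E x →L[ℂ] E x} {x : X}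
    (hγ : MDifferentiableAt 𝓘(ℝ, ℂ) (𝓘(ℝ, ℂ).prod 𝓘(ℝ, F →L[ℝ] F)) (endSection F γ) x)
    (v : TangentSpace 𝓘(ℝ, ℂ) x) : E x →L[ℂ] E x :=
  let a : E x →L[ℝ] E x := TensorialAt.mkHom (A.endCovAux γ x v) x (A.tensorialAt_endCovAux hγ v)
  { toFun := a
    map_add' := map_add a
    map_smul' := fun c e => by
      have hI : a (Complex.I • e) = Complex.I • a e := by
        change A.endCovAux γ x v (FiberBundle.extend F (Complex.I • e)) =
          Complex.I • A.endCovAux γ x v (FiberBundle.extend F e)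
        rw [← A.endCovAux_I_smul hγ v (FiberBundle.mdifferentiableAt_extend ..)]
        exact (A.tensorialAt_endCovAux hγ v).pointwise (FiberBundle.mdifferentiableAt_extend ..)
          (mdifferentiableAt_I_smul_extend e) (by simp)
      have hc : ∀ w : E x, c • w = c.re • w + c.im • Complex.I • w := fun w => by
        conv_lhs => rw [← Complex.re_add_im c, add_smul, mul_smul]
        rfl
      rw [RingHom.id_apply, hc, hc, map_add, map_smul, map_smul, hI]
    cont := a.cont }

open scoped Classical in
/-- The covariant derivative `d_A γ` of a section `γ` of `Hom(E, E)`, a `1`-form with values in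
`Hom(E, E)`. It is characterized by `(∇_v γ) σ = ∇_v (γ σ) - γ (∇_v σ)` for all
differentiable sections `σ` of `E` (and set to `0` where `γ` is not differentiable). -/
def endCov (γ : ∀ x, E x →L[ℂ] E x) (x : X) : TangentSpace 𝓘(ℝ, ℂ) x →ₗ[ℝ] (E x →L[ℂ] E x) :=
  if hγ : MDifferentiableAt 𝓘(ℝ, ℂ) (𝓘(ℝ, ℂ).prod 𝓘(ℝ, F →L[ℝ] F)) (endSection F γ) x then
    { toFun := A.endCovOfDifferentiable hγ
      map_add' := fun v w => by
        ext e
        simp [endCovOfDifferentiable, TensorialAt.mkHom_apply_eq_extend, endCovAux]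
        abel
      map_smul' := fun r v => by
        ext e
        have h4 (r : ℝ) (w : E x) : γ x (r • w) = r • γ x w :=
          ((γ x).restrictScalars ℝ).map_smul r w
        simp [endCovOfDifferentiable, TensorialAt.mkHom_apply_eq_extend, endCovAux, h4, smul_sub] }
  else 0

/-- The `1`-form `d_A γ`, as a function of points and tangent vectors. -/
def dForm (γ : ∀ x, E x →L[ℂ] E x) :
    ∀ x : X, TangentSpace 𝓘(ℝ, ℂ) x → (E x →L[ℂ] E x) :=
  fun x v => A.endCov γ x v

theorem endCov_apply {γ : ∀ x, E x →L[ℂ] E x} {x : X}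
    (hγ : MDifferentiableAt 𝓘(ℝ, ℂ) (𝓘(ℝ, ℂ).prod 𝓘(ℝ, F →L[ℝ] F)) (endSection F γ) x)
    {σ : ∀ x, E x}
    (hσ : MDifferentiableAt 𝓘(ℝ, ℂ) (𝓘(ℝ, ℂ).prod 𝓘(ℝ, F)) (fun y => TotalSpace.mk' F y (σ y)) x)
    (v : TangentSpace 𝓘(ℝ, ℂ) x) :
    A.endCov γ x v (σ x) = A.toFun (fun y => γ y (σ y)) x v - γ x (A.toFun σ x v) := by
  rw [endCov, dif_pos hγ]
  exact TensorialAt.mkHom_apply (A.tensorialAt_endCovAux hγ v) hσ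

end UnitaryConnection

section Operators

variable {F E} [∀ x, FiniteDimensional ℂ (E x)]

/-- The `(0, 1)`-form `Φ*`, namely `φ* dz̄` if `Φ = φ dz`. -/
def adjointForm (Φ : ∀ x : X, TangentSpace 𝓘(ℝ, ℂ) x → (E x →L[ℂ] E x)) :
    ∀ x : X, TangentSpace 𝓘(ℝ, ℂ) x → (E x →L[ℂ] E x) :=
  fun x v => endAdjoint (Φ x v)

/-- The `1`-form `[α, γ]`, for a `1`-form `α` and a section `γ`. -/
def formBracket (α : ∀ x : X, TangentSpace 𝓘(ℝ, ℂ) x → (E x →L[ℂ] E x))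
    (γ : ∀ x, E x →L[ℂ] E x) : ∀ x : X, TangentSpace 𝓘(ℝ, ℂ) x → (E x →L[ℂ] E x) :=
  fun x v => ⁅α x v, γ x⁆

/-- The `2`-form `[α ∧ β]`, for `1`-forms `α` and `β`. -/
def wedgeBracket (α β : ∀ x : X, TangentSpace 𝓘(ℝ, ℂ) x → (E x →L[ℂ] E x)) :
    ∀ x : X, TangentSpace 𝓘(ℝ, ℂ) x → TangentSpace 𝓘(ℝ, ℂ) x → (E x →L[ℂ] E x) :=
  fun x v w => ⁅α x v, β x w⁆ - ⁅α x w, β x v⁆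

/-- The Hodge star on `1`-forms, `(∗α)(v) = -α(Jv)`, so that `∗dx = dy` and `∗dy = -dx`. -/
def starOne (α : ∀ x : X, TangentSpace 𝓘(ℝ, ℂ) x → (E x →L[ℂ] E x)) :
    ∀ x : X, TangentSpace 𝓘(ℝ, ℂ) x → (E x →L[ℂ] E x) :=
  fun x v => -α x (tangentJ x v)

/-- The Hodge star on `2`-forms: the value on an oriented orthonormal basis, which is obtained
from the oriented orthogonal basis `∂/∂x`, `∂/∂y = J ∂/∂x` of vectors of equal length. -/
def starTwo (g : ConformalMetric X)
    (η : ∀ x : X, TangentSpace 𝓘(ℝ, ℂ) x → TangentSpace 𝓘(ℝ, ℂ) x → (E x →L[ℂ] E x)) :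
    ∀ x, E x →L[ℂ] E x :=
  fun x => (g.inner x (tangentOne x) (tangentOne x))⁻¹ •
    η x (tangentOne x) (tangentJ x (tangentOne x))

/-- The exterior covariant derivative of a `1`-form `β` with values in `Hom(E, E)`,
`(d_A β)(V, W) = ∇_V (β(W)) - ∇_W (β(V)) - β([V, W])`, where `V`, `W` are vector fields which
extend the given tangent vectors. -/
def extCov (A : UnitaryConnection F E)
    (β : ∀ x : X, TangentSpace 𝓘(ℝ, ℂ) x → (E x →L[ℂ] E x)) :
    ∀ x : X, TangentSpace 𝓘(ℝ, ℂ) x → TangentSpace 𝓘(ℝ, ℂ) x → (E x →L[ℂ] E x) :=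
  fun x v w =>
    let V : ∀ y : X, TangentSpace 𝓘(ℝ, ℂ) y := FiberBundle.extend ℂ v
    let W : ∀ y : X, TangentSpace 𝓘(ℝ, ℂ) y := FiberBundle.extend ℂ w
    A.endCov (fun y => β y (W y)) x v - A.endCov (fun y => β y (V y)) x w
      - β x (VectorField.mlieBracket 𝓘(ℝ, ℂ) V W x)

/-- The connection Laplacian `Δ_A γ = d_A^* d_A γ`, where `d_A^* = -∗ d_A ∗` on `1`-forms. -/
def laplacian (g : ConformalMetric X) (A : UnitaryConnection F E) (γ : ∀ x, E x →L[ℂ] E x) :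
    ∀ x, E x →L[ℂ] E x :=
  fun x => -starTwo g (extCov A (starOne (A.dForm γ))) x

/-- The `2`-form `M_Φ γ = [Φ* ∧ [Φ, γ]] - [Φ ∧ [Φ*, γ]]`. -/
def higgsTerm (Φ : ∀ x : X, TangentSpace 𝓘(ℝ, ℂ) x → (E x →L[ℂ] E x))
    (γ : ∀ x, E x →L[ℂ] E x) :
    ∀ x : X, TangentSpace 𝓘(ℝ, ℂ) x → TangentSpace 𝓘(ℝ, ℂ) x → (E x →L[ℂ] E x) :=
  wedgeBracket (adjointForm Φ) (formBracket Φ γ) - wedgeBracket Φ (formBracket (adjointForm Φ) γ)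

/-- The linearized operator `L_t γ = Δ_A γ - i t² ∗ M_Φ γ`. -/
def linearization (g : ConformalMetric X) (A : UnitaryConnection F E)
    (Φ : ∀ x : X, TangentSpace 𝓘(ℝ, ℂ) x → (E x →L[ℂ] E x)) (t : ℝ)
    (γ : ∀ x, E x →L[ℂ] E x) : ∀ x, E x →L[ℂ] E x :=
  fun x => laplacian g A γ x - (Complex.I * (t : ℂ) ^ 2) • starTwo g (higgsTerm Φ γ) x

/-- The pointwise square norm of a `1`-form `α`: the sum of `|α(e)|²` over an orthonormal basis of
the tangent space. -/
def formNormSq (g : ConformalMetric X)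
    (α : ∀ x : X, TangentSpace 𝓘(ℝ, ℂ) x → (E x →L[ℂ] E x)) (x : X) : ℝ :=
  (g.inner x (tangentOne x) (tangentOne x))⁻¹ *
    (endNormSq (α x (tangentOne x)) + endNormSq (α x (tangentJ x (tangentOne x))))

/-- The pointwise square norm of a `(1, 0)`-form `ψ dz`, normalized by `|dz| = 1` for a
coordinate `z` in which the metric at the point is `|dz|²`: it is `|ψ dz(e)|²` for any unit
tangent vector `e`. -/
def typeOneZeroNormSq (g : ConformalMetric X)
    (α : ∀ x : X, TangentSpace 𝓘(ℝ, ℂ) x → (E x →L[ℂ] E x)) (x : X) : ℝ :=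
  (g.inner x (tangentOne x) (tangentOne x))⁻¹ * endNormSq (α x (tangentOne x))

/-- The `L²` inner product of two sections of `Hom(E, E)`. -/
def l2Inner [MeasurableSpace X] (g : ConformalMetric X) (a b : ∀ x, E x →L[ℂ] E x) : ℂ :=
  ∫ x, endInner (a x) (b x) ∂g.area

/-- The square of the `L²` norm of a `1`-form. -/
def l2NormSq [MeasurableSpace X] (g : ConformalMetric X)
    (α : ∀ x : X, TangentSpace 𝓘(ℝ, ℂ) x → (E x →L[ℂ] E x)) : ℝ :=
  ∫ x, formNormSq g α x ∂g.area

/-- The square of the `L²` norm of a `(1, 0)`-form, normalized by `|dz| = 1`. -/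
def l2NormSqOneZero [MeasurableSpace X] (g : ConformalMetric X)
    (α : ∀ x : X, TangentSpace 𝓘(ℝ, ℂ) x → (E x →L[ℂ] E x)) : ℝ :=
  ∫ x, typeOneZeroNormSq g α x ∂g.area

end Operators

end Bundles

end HiggsBundle

end

/-!
The identity is the integral of a pointwise one. For a Hermitian section `γ` put `f = |γ|² = Tr γ²`.
Then, at each point,
`⟨L_t γ, γ⟩ = |d_A γ|² + 4 t² |[Φ, γ]|² - ½ Δf`,
where `Δf` is the Laplacian of the function `f` with the analysts' sign (`endInner_linearization`),
and a Laplacian has integral zero over a closed surface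
(`ConformalMetric.integral_surfaceLaplacian`).

The pointwise identity has two halves. In a chart, the fields `V = ∂/∂x` and `W = ∂/∂y = JV`
commute, so that `Δ_A γ = -ρ⁻¹ (∇_V ∇_V γ + ∇_W ∇_W γ)` (`laplacian_eq`), where the metric is
`ρ |dz|²`. A connection differentiates traces, `d (Tr a) = Tr (∇a)`, because in a trivialization of
`E` it acts on endomorphisms as `d + [θ, ·]` (`UnitaryConnection.mvfderiv_re_endTrace`); hence
`∂_V ∂_V f = 2 Tr (∇_V ∇_V γ γ) + 2 Tr ((∇_V γ)²)`. As the connection is unitary, `∇_V γ` is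
Hermitian (`UnitaryConnection.isSymmetric_endCov`), so that the last trace is `|∇_V γ|²`. The half
which concerns the Higgs field is linear algebra: with `Φ = φ dz`, the form `M_Φ γ` takes the value
`2i ([φ*, [φ, γ]] + [φ, [φ*, γ]])` on `∂/∂x`, `∂/∂y`, and `ad φ*` is minus the adjoint of `ad φ`
(`endTrace_lie_lie`).

The integral of the Laplacian vanishes by a partition of unity, since `ρ Δf` is the flat Laplacian
in every chart (`ConformalMetric.density_mul_surfaceLaplacian`), and since the area measure is
`ρ dx dy` in every chart (`ConformalMetric.area_restrict_source`). The same description shows that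
the area measure is finite on a compact surface and positive on nonempty open sets. Norms of
differentiable forms are continuous (`continuous_formNormSq`, through Gram matrices of local
frames), so all the integrands are integrable, and a vanishing integral of
`|d_A γ|² + 4 t² |[Φ, γ]|²` forces both terms to vanish at every point.
-/

noncomputable section

/-! ### The Laplacian of the plane -/

namespace HiggsBundle

open InnerProductSpace Laplacian Topology Filter

section Plane

theorem laplacian_eq_fderiv_fderiv {h : ℂ → ℝ} {z : ℂ} (hh : ContDiffAt ℝ 2 h z) :
    Δ h z = fderiv ℝ (fun w => fderiv ℝ h w 1) z 1 +
      fderiv ℝ (fun w => fderiv ℝ h w Complex.I) z Complex.I := by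
  have hd : DifferentiableAt ℝ (fderiv ℝ h) z :=
    (hh.fderiv_right (m := 1) (by norm_num)).differentiableAt one_ne_zero
  rw [laplacian_eq_iteratedFDeriv_complexPlane]
  simp only [iteratedFDeriv_two_apply]
  rw [fderiv_clm_apply hd (differentiableAt_const _),
    fderiv_clm_apply hd (differentiableAt_const _)]
  simp

/-- The Laplacian is conformally covariant: the second derivatives of `φ` in the directions `1` and
`i` are opposite, and the derivative of `φ` is a similarity. -/
theorem laplacian_comp_holomorphic {h : ℂ → ℝ} {φ : ℂ → ℂ} {z : ℂ} (hφ : AnalyticAt ℂ φ z)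
    (hh : ContDiffAt ℝ 2 h (φ z)) :
    Δ (h ∘ φ) z = ‖deriv φ z‖ ^ 2 * Δ h (φ z) := by
  have hφd : ∀ᶠ w in 𝓝 z, AnalyticAt ℂ φ w := hφ.eventually_analyticAt
  have hhe : ∀ᶠ w in 𝓝 z, ContDiffAt ℝ 2 h (φ w) :=
    hφ.continuousAt.eventually (hh.eventually (by simp))
  have hφR : ContDiffAt ℝ 2 φ z := (hφ.contDiffAt (n := 2)).restrict_scalars ℝ
  have hd : DifferentiableAt ℝ (fderiv ℝ h) (φ z) :=
    (hh.fderiv_right (m := 1) (by norm_num)).differentiableAt one_ne_zero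
  -- the first derivative of the composition
  have h1 (v : ℂ) : (fun w => fderiv ℝ (h ∘ φ) w v) =ᶠ[𝓝 z]
      fun w => fderiv ℝ h (φ w) (deriv φ w * v) := by
    filter_upwards [hφd, hhe] with w hw hw'
    have hf : HasFDerivAt φ ((fderiv ℂ φ w).restrictScalars ℝ) w :=
      hw.differentiableAt.hasFDerivAt.restrictScalars ℝ
    rw [fderiv_comp w (hw'.differentiableAt two_ne_zero) hf.differentiableAt, hf.fderiv]
    simp [mul_comm]
  have hD : HasFDerivAt φ ((fderiv ℂ φ z).restrictScalars ℝ) z :=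
    hφ.differentiableAt.hasFDerivAt.restrictScalars ℝ
  have hD' : HasFDerivAt (deriv φ) ((fderiv ℂ (deriv φ) z).restrictScalars ℝ) z :=
    hφ.deriv.differentiableAt.hasFDerivAt.restrictScalars ℝ
  have h2 (v : ℂ) : fderiv ℝ (fun w => fderiv ℝ (h ∘ φ) w v) z v =
      fderiv ℝ (fderiv ℝ h) (φ z) (deriv φ z * v) (deriv φ z * v) +
        fderiv ℝ h (φ z) (deriv (deriv φ) z * v * v) := by
    rw [(h1 v).fderiv_eq]
    have hA : HasFDerivAt (fun w => fderiv ℝ h (φ w))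
        ((fderiv ℝ (fderiv ℝ h) (φ z)).comp ((fderiv ℂ φ z).restrictScalars ℝ)) z :=
      hd.hasFDerivAt.comp z hD
    have hB : HasFDerivAt (fun w => deriv φ w * v)
        (v • (fderiv ℂ (deriv φ) z).restrictScalars ℝ) z := hD'.mul_const v
    rw [(hA.clm_apply hB).fderiv]
    have e1 (u : ℂ) : fderiv ℂ φ z u = deriv φ z * u := by simp [mul_comm]
    have e2 (u : ℂ) : fderiv ℂ (deriv φ) z u = deriv (deriv φ) z * u := by simp [mul_comm]
    simp only [add_apply, ContinuousLinearMap.comp_apply, ContinuousLinearMap.flip_apply,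
      smul_apply, ContinuousLinearMap.coe_restrictScalars', e1, e2, smul_eq_mul]
    rw [add_comm]
    congr 2
    ring
  have hcomp : ContDiffAt ℝ 2 (h ∘ φ) z := hh.comp z hφR
  rw [laplacian_eq_fderiv_fderiv hcomp, h2, h2, laplacian_eq_iteratedFDeriv_complexPlane]
  simp only [iteratedFDeriv_two_apply]
  have e3 : deriv (deriv φ) z * Complex.I * Complex.I = -(deriv (deriv φ) z * 1 * 1) := by
    rw [mul_assoc, Complex.I_mul_I]; ring
  rw [e3, map_neg]
  set B := fderiv ℝ (fderiv ℝ h) (φ z)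
  set c := deriv φ z
  have e4 : c * 1 = c.re • (1 : ℂ) + c.im • Complex.I := by
    apply Complex.ext <;> simp
  have e5 : c * Complex.I = c.re • Complex.I - c.im • (1 : ℂ) := by
    apply Complex.ext <;> simp
  rw [e4, e5, ← Complex.normSq_eq_norm_sq, Complex.normSq_apply]
  simp only [map_add, map_sub, map_smul, add_apply, sub_apply, smul_apply, smul_eq_mul,
    Matrix.cons_val_zero, Matrix.cons_val_one]
  ring

theorem integral_fderiv_apply_eq_zero {h : ℂ → ℝ} (hh : ContDiff ℝ 1 h)
    (hc : HasCompactSupport h) (v : ℂ) : ∫ z, fderiv ℝ h z v = 0 := by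
  have hcont : Continuous fun z => fderiv ℝ h z v :=
    (hh.continuous_fderiv one_ne_zero).clm_apply continuous_const
  have hcs : HasCompactSupport fun z => fderiv ℝ h z v :=
    (hc.fderiv ℝ).comp_left (g := fun L : ℂ →L[ℝ] ℝ => L v) rfl
  have key := integral_bilinear_hasLineDerivAt_right_eq_neg_left_of_integrable (μ := volume)
    (f := fun _ : ℂ => (1 : ℝ)) (f' := fun _ => 0) (g := h) (g' := fun z => fderiv ℝ h z v) (v := v)
    (B := ContinuousLinearMap.mul ℝ ℝ) (by simp)
    (by simpa using hcont.integrable_of_hasCompactSupport hcs)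
    (by simpa using hh.continuous.integrable_of_hasCompactSupport hc)
    (fun x _ => (hasFDerivAt_const (1 : ℝ) x).hasLineDerivAt v)
    (fun x _ => ((hh.differentiable one_ne_zero) x).hasFDerivAt.hasLineDerivAt v)
  simpa using key

theorem integral_laplacian_eq_zero {h : ℂ → ℝ} (hh : ContDiff ℝ 2 h)
    (hc : HasCompactSupport h) : ∫ z, Δ h z = 0 := by
  have h1 (v : ℂ) : ContDiff ℝ 1 fun w => fderiv ℝ h w v :=
    (hh.fderiv_right (m := 1) (by norm_num)).clm_apply contDiff_const
  have h2 (v : ℂ) : HasCompactSupport fun w => fderiv ℝ h w v :=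
    (hc.fderiv ℝ).comp_left (g := fun L : ℂ →L[ℝ] ℝ => L v) rfl
  have h3 (v : ℂ) : Integrable fun z => fderiv ℝ (fun w => fderiv ℝ h w v) z v :=
    (((h1 v).continuous_fderiv one_ne_zero).clm_apply
      continuous_const).integrable_of_hasCompactSupport
      (((h2 v).fderiv ℝ).comp_left (g := fun L : ℂ →L[ℝ] ℝ => L v) rfl)
  simp_rw [fun z => laplacian_eq_fderiv_fderiv (hh.contDiffAt (x := z))]
  rw [integral_add (h3 _) (h3 _), integral_fderiv_apply_eq_zero (h1 _) (h2 _),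
    integral_fderiv_apply_eq_zero (h1 _) (h2 _), add_zero]

end Plane

end HiggsBundle

/-! ### Charts of a Riemann surface -/

namespace HiggsBundle

open InnerProductSpace Laplacian Topology Filter

section Charts

variable {X : Type*} [TopologicalSpace X] [ChartedSpace ℂ X]

/-- The tangent vector at `x` with coordinate `c` in the chart of the atlas preferred at `x`. -/
def tangentOf (x : X) (c : ℂ) : TangentSpace 𝓘(ℝ, ℂ) x := c

/-- The complex derivative at `e x` of the coordinate change from the chart `e` to the chart
preferred at `x`, so that the coordinate vector field `∂/∂x` of `e` is
`tangentOf x (chartDeriv e x)` at the point `x`. -/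
def chartDeriv (e : OpenPartialHomeomorph X ℂ) (x : X) : ℂ := deriv (chartAt ℂ x ∘ e.symm) (e x)

theorem tangentJ_tangentOf (x : X) (c : ℂ) :
    tangentJ x (tangentOf x c) = tangentOf x (Complex.I * c) := rfl

theorem tangentOf_eq (x : X) (c : ℂ) :
    tangentOf x c = c.re • tangentOne x + c.im • tangentJ x (tangentOne x) := by
  change c = c.re • (1 : ℂ) + c.im • (Complex.I * 1)
  apply Complex.ext <;> simp

theorem map_tangentOf {G : Type*} [AddCommGroup G] [Module ℝ G] {x : X}
    (L : TangentSpace 𝓘(ℝ, ℂ) x →ₗ[ℝ] G) (c : ℂ) :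
    L (tangentOf x c) = c.re • L (tangentOne x) + c.im • L (tangentJ x (tangentOne x)) := by
  rw [tangentOf_eq, map_add, map_smul, map_smul]

theorem chartDeriv_chartAt (x : X) : chartDeriv (chartAt ℂ x) x = 1 := by
  have h : chartAt ℂ x ∘ (chartAt ℂ x).symm =ᶠ[𝓝 (chartAt ℂ x x)] id := by
    filter_upwards [(chartAt ℂ x).open_target.mem_nhds (mem_chart_target ℂ x)] with z hz
    exact (chartAt ℂ x).right_inv hz
  rw [chartDeriv, h.deriv_eq, deriv_id]

variable [IsManifold 𝓘(ℂ) ω X] {e e' : OpenPartialHomeomorph X ℂ}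

theorem analyticAt_coordChange (he : e ∈ atlas ℂ X) (he' : e' ∈ atlas ℂ X) {x : X}
    (hx : x ∈ e.source) (hx' : x ∈ e'.source) : AnalyticAt ℂ (e' ∘ e.symm) (e x) := by
  have h1 : e.symm.trans e' ∈ contDiffGroupoid ω 𝓘(ℂ) := HasGroupoid.compatible he he'
  rw [contDiffGroupoid, mem_groupoid_of_pregroupoid] at h1
  have h3 : ContDiffOn ℂ ω (𝓘(ℂ) ∘ e.symm.trans e' ∘ 𝓘(ℂ).symm)
    (𝓘(ℂ).symm ⁻¹' (e.symm.trans e').source ∩ Set.range 𝓘(ℂ)) := h1.1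
  have h4 : ContDiffOn ℂ ω (e' ∘ e.symm) (e.symm.trans e').source := by simpa using h3
  have hmem : e x ∈ (e.symm.trans e').source := by simp [hx, hx']
  exact (h4.contDiffAt ((e.symm.trans e').open_source.mem_nhds hmem)).analyticAt

theorem analyticAt_chartDeriv (he : e ∈ atlas ℂ X) {x : X} (hx : x ∈ e.source) :
    AnalyticAt ℂ (chartAt ℂ x ∘ e.symm) (e x) :=
  analyticAt_coordChange he (chart_mem_atlas ℂ x) hx (mem_chart_source ℂ x)

theorem deriv_coordChange_trans (he : e ∈ atlas ℂ X) (he' : e' ∈ atlas ℂ X)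
    {f : OpenPartialHomeomorph X ℂ} (hf : f ∈ atlas ℂ X) {x : X} (hx : x ∈ e.source)
    (hx' : x ∈ e'.source) (hxf : x ∈ f.source) :
    deriv (f ∘ e.symm) (e x) = deriv (f ∘ e'.symm) (e' x) * deriv (e' ∘ e.symm) (e x) := by
  have h : f ∘ e.symm =ᶠ[𝓝 (e x)] (f ∘ e'.symm) ∘ (e' ∘ e.symm) := by
    have : e.symm ⁻¹' e'.source ∈ 𝓝 (e x) :=
      (e.continuousAt_symm (e.map_source hx)).preimage_mem_nhds
        (by rw [e.left_inv hx]; exact e'.open_source.mem_nhds hx')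
    filter_upwards [this] with z hz
    simp [e'.left_inv hz]
  have h1 : (e' ∘ e.symm) (e x) = e' x := by simp [e.left_inv hx]
  rw [h.deriv_eq, deriv_comp, h1]
  · rw [h1]; exact (analyticAt_coordChange he' hf hx' hxf).differentiableAt
  · exact (analyticAt_coordChange he he' hx hx').differentiableAt

theorem chartDeriv_eq_mul (he : e ∈ atlas ℂ X) (he' : e' ∈ atlas ℂ X) {x : X} (hx : x ∈ e.source)
    (hx' : x ∈ e'.source) :
    chartDeriv e x = chartDeriv e' x * deriv (e' ∘ e.symm) (e x) :=
  deriv_coordChange_trans he he' (chart_mem_atlas ℂ x) hx hx' (mem_chart_source ℂ x)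

theorem chartDeriv_ne_zero (he : e ∈ atlas ℂ X) {x : X} (hx : x ∈ e.source) :
    chartDeriv e x ≠ 0 := by
  have h := chartDeriv_eq_mul (chart_mem_atlas ℂ x) he (mem_chart_source ℂ x) hx
  rw [chartDeriv_chartAt] at h
  exact left_ne_zero_of_mul (h ▸ one_ne_zero)

theorem mfderiv_chart_symm (he : e ∈ atlas ℂ X) {z : ℂ} (hz : z ∈ e.target) (w : ℂ) :
    mfderiv 𝓘(ℝ, ℂ) 𝓘(ℝ, ℂ) e.symm z w =
      tangentOf (e.symm z) (chartDeriv e (e.symm z) * w) := by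
  have hm : MDifferentiableAt 𝓘(ℝ, ℂ) 𝓘(ℝ, ℂ) e.symm z :=
    mdifferentiableAt_atlas_symm (I := 𝓘(ℝ, ℂ)) he hz
  have ha := analyticAt_chartDeriv he (e.map_target hz)
  rw [e.right_inv hz] at ha
  have h2 : writtenInExtChartAt 𝓘(ℝ, ℂ) 𝓘(ℝ, ℂ) z e.symm = chartAt ℂ (e.symm z) ∘ e.symm := by
    ext z
    simp [writtenInExtChartAt, chartAt_self_eq]
  rw [hm.mfderiv, h2]
  have hf := ha.differentiableAt.hasFDerivAt.restrictScalars ℝ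
  simp only [extChartAt_self_eq, modelWithCornersSelf_coe, Set.range_id, fderivWithin_univ, id]
  change fderiv ℝ (chartAt ℂ (e.symm z) ∘ e.symm) z w = _
  rw [hf.fderiv]
  change fderiv ℂ (chartAt ℂ (e.symm z) ∘ e.symm) z w = chartDeriv e (e.symm z) * w
  simp [chartDeriv, mul_comm, e.right_inv hz]

theorem extend_tangentOf {x₀ y : X} (hy : y ∈ (chartAt ℂ x₀).source) (v : ℂ) :
    FiberBundle.extend ℂ (tangentOf x₀ v) y =
      tangentOf y (chartDeriv (chartAt ℂ x₀) y * v) := by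
  have h1 := TangentBundle.symmL_trivializationAt_eq_core (I := 𝓘(ℝ, ℂ)) hy
  have h2 : (trivializationAt ℂ (TangentSpace 𝓘(ℝ, ℂ)) x₀ ⟨x₀, tangentOf x₀ v⟩).2 = v :=
    tangentCoordChange_self (I := 𝓘(ℝ, ℂ)) (x := x₀) (z := x₀) (by simp)
  have h3 := congrArg (fun L => L v) h1
  have h4 : FiberBundle.extend ℂ (tangentOf x₀ v) y =
      (trivializationAt ℂ (TangentSpace 𝓘(ℝ, ℂ)) x₀).symm y v := by
    unfold FiberBundle.extend
    rw [h2]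
  have hy' : y ∈ (trivializationAt ℂ (TangentSpace 𝓘(ℝ, ℂ) : X → Type _) x₀).baseSet := hy
  rw [h4, ← Trivialization.symmL_apply (R := ℝ) _ hy', h3]
  have hf := (analyticAt_chartDeriv (chart_mem_atlas ℂ x₀) hy).differentiableAt.hasFDerivAt
    |>.restrictScalars ℝ
  change fderivWithin ℝ (chartAt ℂ y ∘ (chartAt ℂ x₀).symm) (Set.range id) (chartAt ℂ x₀ y) v
    = chartDeriv (chartAt ℂ x₀) y * v
  rw [Set.range_id, fderivWithin_univ, hf.fderiv]
  change fderiv ℂ (chartAt ℂ y ∘ (chartAt ℂ x₀).symm) (chartAt ℂ x₀ y) v = _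
  simp [chartDeriv, mul_comm]

theorem mfderiv_tangentOf (he : e ∈ atlas ℂ X) {x : X} (hx : x ∈ e.source) {f : X → ℝ}
    (hf : MDifferentiableAt 𝓘(ℝ, ℂ) 𝓘(ℝ, ℝ) f x) (w : ℂ) :
    (mfderiv 𝓘(ℝ, ℂ) 𝓘(ℝ, ℝ) f x (tangentOf x (chartDeriv e x * w)) : ℝ) =
      fderiv ℝ (f ∘ e.symm) (e x) w := by
  obtain ⟨z, hz, rfl⟩ : ∃ z ∈ e.target, e.symm z = x := ⟨e x, e.map_source hx, e.left_inv hx⟩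
  have hm : MDifferentiableAt 𝓘(ℝ, ℂ) 𝓘(ℝ, ℂ) e.symm z :=
    mdifferentiableAt_atlas_symm (I := 𝓘(ℝ, ℂ)) he hz
  rw [e.right_inv hz, ← mfderiv_eq_fderiv, mfderiv_comp z hf hm]
  exact congrArg (mfderiv 𝓘(ℝ, ℂ) 𝓘(ℝ, ℝ) f (e.symm z)) (mfderiv_chart_symm he hz w).symm

/-- The coordinate vector fields of a chart commute. -/
theorem mlieBracket_extend (x : X) (v w : TangentSpace 𝓘(ℝ, ℂ) x) :
    VectorField.mlieBracket 𝓘(ℝ, ℂ) (FiberBundle.extend ℂ v) (FiberBundle.extend ℂ w) x = 0 := by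
  -- in the chart, such a vector field is constant
  have key (u : ℂ) : VectorField.mpullbackWithin 𝓘(ℝ, ℂ) 𝓘(ℝ, ℂ) (extChartAt 𝓘(ℝ, ℂ) x).symm
      (FiberBundle.extend ℂ (tangentOf x u)) (Set.range 𝓘(ℝ, ℂ))
      =ᶠ[𝓝 (extChartAt 𝓘(ℝ, ℂ) x x)] fun _ => u := by
    filter_upwards [(chartAt ℂ x).open_target.mem_nhds (mem_chart_target ℂ x)] with z hz
    have hy : (chartAt ℂ x).symm z ∈ (chartAt ℂ x).source := (chartAt ℂ x).map_target hz
    have hinv : (mfderivWithin 𝓘(ℝ, ℂ) 𝓘(ℝ, ℂ) (extChartAt 𝓘(ℝ, ℂ) x).symm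
        (Set.range 𝓘(ℝ, ℂ)) z).IsInvertible :=
      isInvertible_mfderivWithin_extChartAt_symm (by simpa using hz)
    rw [VectorField.mpullbackWithin_apply]
    have h1 : FiberBundle.extend ℂ (tangentOf x u) ((extChartAt 𝓘(ℝ, ℂ) x).symm z) =
        mfderivWithin 𝓘(ℝ, ℂ) 𝓘(ℝ, ℂ) (extChartAt 𝓘(ℝ, ℂ) x).symm (Set.range 𝓘(ℝ, ℂ)) z u := by
      rw [modelWithCornersSelf_coe, Set.range_id, mfderivWithin_univ]
      refine (extend_tangentOf hy u).trans ?_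
      exact (mfderiv_chart_symm (chart_mem_atlas ℂ x) hz u).symm
    rw [h1]
    exact hinv.inverse_apply_eq.2 rfl
  rw [← VectorField.mlieBracketWithin_univ, VectorField.mlieBracketWithin_apply]
  have aux {V W : ℂ → ℂ} {s : Set ℂ} {z a b : ℂ} (hs : s = Set.univ) (hV : V =ᶠ[𝓝 z] fun _ => a)
      (hW : W =ᶠ[𝓝 z] fun _ => b) : VectorField.lieBracketWithin ℝ V W s z = 0 := by
    rw [hs, VectorField.lieBracketWithin_univ, hV.lieBracket_vectorField_eq hW]
    simp [VectorField.lieBracket]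
  exact (congrArg _ (aux (by simp) (key v) (key w))).trans (map_zero _)

end Charts

end HiggsBundle

/-! ### The area measure -/

namespace HiggsBundle

open InnerProductSpace Laplacian Topology Filter
open scoped ENNReal

section

variable {X : Type*} [TopologicalSpace X] [MeasurableSpace X] [BorelSpace X]

theorem measurableSet_target_inter_preimage (e : OpenPartialHomeomorph X ℂ) {S : Set X}
    (hS : MeasurableSet S) : MeasurableSet (e.target ∩ e.symm ⁻¹' S) := by
  have h := (continuousOn_iff_continuous_domRestrict.1 e.continuousOn_symm).measurable hS
  have h2 := e.open_target.measurableSet.subtype_image h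
  convert h2 using 1
  ext z
  simp [and_comm]

theorem aemeasurable_chart_symm (e : OpenPartialHomeomorph X ℂ) (ρ : ℂ → ℝ≥0∞) :
    AEMeasurable e.symm ((volume.restrict e.target).withDensity ρ) :=
  (e.continuousOn_symm.aemeasurable e.open_target.measurableSet).mono_ac
    (withDensity_absolutelyContinuous _ _)

end

namespace ConformalMetric

variable {X : Type*} [TopologicalSpace X] [ChartedSpace ℂ X] [IsManifold 𝓘(ℂ) ω X]
  (g : ConformalMetric X) {e e' : OpenPartialHomeomorph X ℂ}

/-- The square length of the coordinate vector `∂/∂x` at the point `x`, in the chart preferred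
at `x`. -/
def factor (x : X) : ℝ := g.inner x (tangentOne x) (tangentOne x)

theorem factor_pos (x : X) : 0 < g.factor x :=
  g.pos x _ (one_ne_zero : (1 : ℂ) ≠ 0)

theorem inner_tangentOf (x : X) (c : ℂ) :
    g.inner x (tangentOf x c) (tangentOf x c) = ‖c‖ ^ 2 * g.factor x := by
  have h1 : g.inner x (tangentJ x (tangentOne x)) (tangentJ x (tangentOne x)) = g.factor x :=
    g.inner_J x _ _
  have h2 : g.inner x (tangentJ x (tangentOne x)) (tangentOne x) = 0 := by
    have h3 := g.inner_J x (tangentJ x (tangentOne x)) (tangentOne x)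
    have h4 : tangentJ x (tangentJ x (tangentOne x)) = -tangentOne x := by
      change Complex.I * (Complex.I * 1) = -1
      rw [mul_one, Complex.I_mul_I]
    rw [h4, map_neg, neg_apply, g.symm x (tangentOne x)] at h3
    linarith
  have h5 : g.inner x (tangentOne x) (tangentJ x (tangentOne x)) = 0 := by rw [g.symm, h2]
  rw [tangentOf_eq]
  simp only [map_add, map_smul, add_apply, smul_apply, smul_eq_mul, h1, h2, h5]
  rw [← Complex.normSq_eq_norm_sq, Complex.normSq_apply, factor]
  ring

theorem density_eq (he : e ∈ atlas ℂ X) {z : ℂ} (hz : z ∈ e.target) :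
    g.density e z = ‖chartDeriv e (e.symm z)‖ ^ 2 * g.factor (e.symm z) := by
  have h := mfderiv_chart_symm he hz 1
  rw [mul_one] at h
  rw [← inner_tangentOf, ← h]
  rfl

theorem density_pos (he : e ∈ atlas ℂ X) {z : ℂ} (hz : z ∈ e.target) : 0 < g.density e z := by
  rw [g.density_eq he hz]
  have := chartDeriv_ne_zero he (e.map_target hz)
  have := g.factor_pos (e.symm z)
  positivity

theorem density_eq_mul (he : e ∈ atlas ℂ X) (he' : e' ∈ atlas ℂ X) {z : ℂ} (hz : z ∈ e.target)
    (hz' : e.symm z ∈ e'.source) :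
    g.density e z = ‖deriv (e' ∘ e.symm) z‖ ^ 2 * g.density e' (e' (e.symm z)) := by
  rw [g.density_eq he hz, g.density_eq he' (e'.map_source hz'), e'.left_inv hz',
    chartDeriv_eq_mul he he' (e.map_target hz) hz', e.right_inv hz, norm_mul]
  ring

theorem continuousAt_inner_extend (x : X) (v : TangentSpace 𝓘(ℝ, ℂ) x) :
    ContinuousAt (fun y => g.inner y (FiberBundle.extend ℂ v y) (FiberBundle.extend ℂ v y)) x := by
  have hv : ContMDiffAt 𝓘(ℝ, ℂ) (𝓘(ℝ, ℂ).prod 𝓘(ℝ, ℂ)) ∞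
      (fun y => TotalSpace.mk' ℂ (E := (TangentSpace 𝓘(ℝ, ℂ) : X → Type _)) y
        (FiberBundle.extend ℂ v y)) x := FiberBundle.contMDiffAt_extend ..
  have h : ContMDiffAt 𝓘(ℝ, ℂ) (𝓘(ℝ, ℂ).prod 𝓘(ℝ)) ∞
      (fun y => TotalSpace.mk' ℝ (E := Bundle.Trivial X ℝ) y
        (g.inner y (FiberBundle.extend ℂ v y) (FiberBundle.extend ℂ v y))) x := by
    apply ContMDiffAt.clm_bundle_apply₂ (F₁ := ℂ) (F₂ := ℂ)
    · exact g.contMDiff.contMDiffAt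
    · exact hv
    · exact hv
  simp only [contMDiffAt_totalSpace] at h
  exact h.2.continuousAt

/-- The function `factor` depends on the chart preferred at each point and need not be continuous;
its product with `|chartDeriv e|²` is the square length of the field `∂/∂x` of a fixed chart `e`. -/
theorem continuousAt_factor_mul (he : e ∈ atlas ℂ X) {x : X} (hx : x ∈ e.source) :
    ContinuousAt (fun y => ‖chartDeriv e y‖ ^ 2 * g.factor y) x := by
  have h1 : ContinuousAt (fun y => ‖chartDeriv (chartAt ℂ x) y‖ ^ 2 * g.factor y) x := by
    refine (g.continuousAt_inner_extend x (tangentOf x 1)).congr ?_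
    filter_upwards [(chartAt ℂ x).open_source.mem_nhds (mem_chart_source ℂ x)] with y hy
    rw [extend_tangentOf hy, mul_one, inner_tangentOf]
  have h2 : ContinuousAt (fun y => deriv (chartAt ℂ x ∘ e.symm) (e y)) x :=
    ContinuousAt.comp (analyticAt_chartDeriv he hx).deriv.continuousAt (e.continuousAt hx)
  refine ((h2.norm.pow 2).mul h1).congr ?_
  filter_upwards [(chartAt ℂ x).open_source.mem_nhds (mem_chart_source ℂ x),
    e.open_source.mem_nhds hx] with y hy hy'
  simp only [Pi.mul_apply, Pi.pow_apply]
  rw [chartDeriv_eq_mul he (chart_mem_atlas ℂ x) hy' hy, norm_mul]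
  ring

theorem continuousOn_density (he : e ∈ atlas ℂ X) : ContinuousOn (g.density e) e.target := by
  have h : ContinuousOn (fun z => ‖chartDeriv e (e.symm z)‖ ^ 2 * g.factor (e.symm z)) e.target :=
    fun z hz => ((g.continuousAt_factor_mul he (e.map_target hz)).comp
      (e.continuousAt_symm hz)).continuousWithinAt
  exact h.congr fun z hz => g.density_eq he hz

theorem aemeasurable_density (he : e ∈ atlas ℂ X) :
    AEMeasurable (fun z => ENNReal.ofReal (g.density e z)) (volume.restrict e.target) :=
  ((g.continuousOn_density he).aemeasurable e.open_target.measurableSet).ennreal_ofReal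

variable [MeasurableSpace X]

/-- The measure `ρ dx dy` of a chart, carried to the surface. -/
def chartMeasure (e : OpenPartialHomeomorph X ℂ) : Measure X :=
  Measure.map e.symm
    ((volume.restrict e.target).withDensity fun z => ENNReal.ofReal (g.density e z))

theorem chartMeasure_le_area (he : e ∈ atlas ℂ X) : g.chartMeasure e ≤ g.area :=
  le_iSup₂ (f := fun e (_ : e ∈ atlas ℂ X) => g.chartMeasure e) e he

variable [BorelSpace X]

theorem chartMeasure_apply (e : OpenPartialHomeomorph X ℂ) {S : Set X} (hS : MeasurableSet S) :
    g.chartMeasure e S =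
      ∫⁻ z in e.target ∩ e.symm ⁻¹' S, ENNReal.ofReal (g.density e z) := by
  have hm := measurableSet_target_inter_preimage e hS
  have h1 : e.symm ⁻¹' S =ᵐ[(volume.restrict e.target).withDensity
      fun z => ENNReal.ofReal (g.density e z)] (e.target ∩ e.symm ⁻¹' S : Set ℂ) := by
    have : ∀ᵐ z ∂((volume.restrict e.target).withDensity
        fun z => ENNReal.ofReal (g.density e z)), z ∈ e.target :=
      (withDensity_absolutelyContinuous _ _).ae_le (ae_restrict_mem e.open_target.measurableSet)
    filter_upwards [this] with z hz
    exact propext ⟨fun h => ⟨hz, h⟩, fun h => h.2⟩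
  rw [chartMeasure, Measure.map_apply_of_aemeasurable (aemeasurable_chart_symm e _) hS,
    measure_congr h1, withDensity_apply _ hm, Measure.restrict_restrict hm]
  congr 2
  rw [Set.inter_assoc, Set.inter_comm, Set.inter_assoc, Set.inter_self, Set.inter_comm]

theorem chartMeasure_inter_source (e : OpenPartialHomeomorph X ℂ) {S : Set X}
    (hS : MeasurableSet S) : g.chartMeasure e (S ∩ e.source) = g.chartMeasure e S := by
  rw [g.chartMeasure_apply e hS, g.chartMeasure_apply e (hS.inter e.open_source.measurableSet)]
  congr 2
  ext z
  constructor
  · rintro ⟨h1, h2⟩; exact ⟨h1, h2.1⟩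
  · rintro ⟨h1, h2⟩; exact ⟨h1, h2, e.map_target h1⟩

/-- The measures of two charts agree on the intersection of the charts, by the change of variables
formula: the Jacobian of a holomorphic map `φ` is `|φ'|²`. -/
theorem chartMeasure_eq_of_subset (he : e ∈ atlas ℂ X) (he' : e' ∈ atlas ℂ X) {S : Set X}
    (hS : MeasurableSet S) (h : S ⊆ e.source) (h' : S ⊆ e'.source) :
    g.chartMeasure e S = g.chartMeasure e' S := by
  rw [g.chartMeasure_apply e hS, g.chartMeasure_apply e' hS]
  set T := e.target ∩ e.symm ⁻¹' S with hT
  have hTm : MeasurableSet T := measurableSet_target_inter_preimage e hS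
  have himg : e'.target ∩ e'.symm ⁻¹' S = (e' ∘ e.symm) '' T := by
    ext w
    constructor
    · rintro ⟨h1, h2⟩
      refine ⟨e (e'.symm w), ⟨e.map_source (h h2), ?_⟩, ?_⟩
      · rw [Set.mem_preimage, e.left_inv (h h2)]; exact h2
      · simp [e.left_inv (h h2), e'.right_inv h1]
    · rintro ⟨z, ⟨h1, h2⟩, rfl⟩
      refine ⟨e'.map_source (h' h2), ?_⟩
      rw [Set.mem_preimage, Function.comp_apply, e'.left_inv (h' h2)]
      exact h2
  have hinj : Set.InjOn (e' ∘ e.symm) T := by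
    intro z hz w hw hzw
    exact e.symm.injOn hz.1 hw.1 (e'.injOn (h' hz.2) (h' hw.2) hzw)
  have hd : ∀ z ∈ T, HasFDerivWithinAt (e' ∘ e.symm)
      ((fderiv ℂ (e' ∘ e.symm) z).restrictScalars ℝ) T z := fun z hz => by
    have ha := analyticAt_coordChange he he' (e.map_target hz.1) (h' hz.2)
    rw [e.right_inv hz.1] at ha
    exact (ha.differentiableAt.hasFDerivAt.restrictScalars ℝ).hasFDerivWithinAt
  rw [himg, lintegral_image_eq_lintegral_abs_det_fderiv_mul volume hTm hd hinj]
  refine setLIntegral_congr_fun hTm fun z hz => ?_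
  have hdet : |((fderiv ℂ (e' ∘ e.symm) z).restrictScalars ℝ).det| =
      ‖deriv (e' ∘ e.symm) z‖ ^ 2 := by
    have h1 : ((fderiv ℂ (e' ∘ e.symm) z).restrictScalars ℝ).det =
        LinearMap.det (((fderiv ℂ (e' ∘ e.symm) z : ℂ →L[ℂ] ℂ) : ℂ →ₗ[ℂ] ℂ).restrictScalars ℝ) :=
      rfl
    rw [h1, LinearMap.det_restrictScalars, LinearMap.det_ring]
    simp [Algebra.norm_complex_apply, Complex.normSq_eq_norm_sq]
  rw [hdet, ← ENNReal.ofReal_mul (by positivity), g.density_eq_mul he he' hz.1 (h' hz.2)]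
  rfl

/-- On the source of a chart, the area is the measure of the chart. Indeed the measure which is that
of the chart on its source, and the area outside, dominates the measures of all charts. -/
theorem area_restrict_source (he : e ∈ atlas ℂ X) :
    g.area.restrict e.source = g.chartMeasure e := by
  have hs : MeasurableSet e.source := e.open_source.measurableSet
  have hle : g.area ≤ g.chartMeasure e + g.area.restrict e.sourceᶜ := by
    refine iSup₂_le fun e' he' => ?_
    change g.chartMeasure e' ≤ _
    refine Measure.le_iff.2 fun S hS => ?_
    rw [← measure_inter_add_sdiff S hs, Measure.add_apply, Measure.restrict_apply hS]
    refine add_le_add ?_ (Measure.le_iff'.1 (g.chartMeasure_le_area he') _)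
    rw [← g.chartMeasure_inter_source e' (hS.inter hs), g.chartMeasure_eq_of_subset he' he
      ((hS.inter hs).inter e'.open_source.measurableSet) (fun x hx => hx.2) (fun x hx => hx.1.2)]
    exact measure_mono fun x hx => hx.1.1
  refine Measure.ext fun S hS => ?_
  rw [Measure.restrict_apply hS]
  apply le_antisymm
  · refine (Measure.le_iff'.1 hle _).trans ?_
    rw [Measure.add_apply, Measure.restrict_apply (hS.inter hs), g.chartMeasure_inter_source e hS]
    simp [Set.inter_assoc]
  · rw [← g.chartMeasure_inter_source e hS]
    exact Measure.le_iff'.1 (g.chartMeasure_le_area he) _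

instance isLocallyFiniteMeasure_area : IsLocallyFiniteMeasure g.area := by
  refine ⟨fun x => ?_⟩
  have he := chart_mem_atlas ℂ x
  set e := chartAt ℂ x
  have hx : x ∈ e.source := mem_chart_source ℂ x
  have hc : ContinuousAt (g.density e) (e x) :=
    (g.continuousOn_density he).continuousAt (e.open_target.mem_nhds (e.map_source hx))
  obtain ⟨C, hC⟩ : ∃ C, g.density e (e x) < C := exists_gt _
  have hU : {z | g.density e z < C} ∩ Metric.ball (e x) 1 ∈ 𝓝 (e x) :=
    inter_mem (hc.eventually_lt continuousAt_const hC) (Metric.ball_mem_nhds _ one_pos)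
  obtain ⟨U, hUs, hUo, hxU⟩ := mem_nhds_iff.1 hU
  have hm : MeasurableSet (e.source ∩ e ⁻¹' U) := (e.isOpen_inter_preimage hUo).measurableSet
  refine ⟨e.source ∩ e ⁻¹' U, (e.isOpen_inter_preimage hUo).mem_nhds ⟨hx, hxU⟩, ?_⟩
  have h1 : g.area (e.source ∩ e ⁻¹' U) = g.chartMeasure e (e.source ∩ e ⁻¹' U) := by
    rw [← g.area_restrict_source he, Measure.restrict_apply hm]
    congr 1
    ext y; simp +contextual
  rw [h1, g.chartMeasure_apply e hm]
  have hsub : e.target ∩ e.symm ⁻¹' (e.source ∩ e ⁻¹' U) ⊆ U := fun z hz => by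
    have := hz.2.2
    rwa [Set.mem_preimage, e.right_inv hz.1] at this
  calc ∫⁻ z in e.target ∩ e.symm ⁻¹' (e.source ∩ e ⁻¹' U), ENNReal.ofReal (g.density e z)
      ≤ ∫⁻ z in U, ENNReal.ofReal (g.density e z) := lintegral_mono_set hsub
    _ ≤ ∫⁻ _ in U, ENNReal.ofReal C :=
        setLIntegral_mono' hUo.measurableSet fun z hz => ENNReal.ofReal_le_ofReal (hUs hz).1.le
    _ ≤ ∫⁻ _ in Metric.ball (e x) 1, ENNReal.ofReal C :=
        lintegral_mono_set fun z hz => (hUs hz).2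
    _ < ⊤ := by
        rw [setLIntegral_const]
        exact ENNReal.mul_lt_top ENNReal.ofReal_lt_top measure_ball_lt_top

instance isOpenPosMeasure_area : g.area.IsOpenPosMeasure := by
  refine ⟨fun V hV ⟨x, hxV⟩ h0 => ?_⟩
  have he := chart_mem_atlas ℂ x
  set e := chartAt ℂ x
  have hx : x ∈ e.source := mem_chart_source ℂ x
  have h1 : g.chartMeasure e V = 0 :=
    le_antisymm ((Measure.le_iff'.1 (g.chartMeasure_le_area he) V).trans h0.le) zero_le
  rw [g.chartMeasure_apply e hV.measurableSet, lintegral_eq_zero_iff'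
    ((g.aemeasurable_density he).mono_set Set.inter_subset_left)] at h1
  have hO : IsOpen (e.target ∩ e.symm ⁻¹' V) := e.isOpen_inter_preimage_symm hV
  have h2 : volume (e.target ∩ e.symm ⁻¹' V) = 0 := by
    have h3 : ∀ᵐ z ∂(volume.restrict (e.target ∩ e.symm ⁻¹' V)), False := by
      filter_upwards [h1, ae_restrict_mem hO.measurableSet] with z hz hz'
      exact (ENNReal.ofReal_pos.2 (g.density_pos he hz'.1)).ne' hz
    simpa [ae_iff] using h3
  exact (hO.measure_pos volume ⟨e x, e.map_source hx, by
    rw [Set.mem_preimage, e.left_inv hx]; exact hxV⟩).ne' h2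

theorem setIntegral_source (he : e ∈ atlas ℂ X) {f : X → ℝ} (hf : Continuous f) :
    ∫ x in e.source, f x ∂g.area = ∫ z in e.target, g.density e z * f (e.symm z) := by
  rw [g.area_restrict_source he, chartMeasure, integral_map (aemeasurable_chart_symm e _)
    hf.aestronglyMeasurable, integral_withDensity_eq_integral_toReal_smul₀
    (g.aemeasurable_density he) (Eventually.of_forall fun _ => ENNReal.ofReal_lt_top)]
  refine setIntegral_congr_fun e.open_target.measurableSet fun z hz => ?_
  simp only [smul_eq_mul]
  rw [ENNReal.toReal_ofReal (g.density_pos he hz).le]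

end ConformalMetric

end HiggsBundle

/-! ### The Laplacian of functions on the surface -/

namespace HiggsBundle

open InnerProductSpace Laplacian Topology Filter

section

theorem two_le_infty : (2 : WithTop ℕ∞) ≤ ∞ := by
  change ((2 : ℕ∞) : WithTop ℕ∞) ≤ ((⊤ : ℕ∞) : WithTop ℕ∞)
  exact WithTop.coe_le_coe.2 le_top

variable {X : Type*} [TopologicalSpace X] [ChartedSpace ℂ X] [IsManifold 𝓘(ℂ) ω X]
  {e : OpenPartialHomeomorph X ℂ}

theorem contDiffAt_comp_chart_symm (he : e ∈ atlas ℂ X) {f : X → ℝ}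
    (hf : ContMDiff 𝓘(ℝ, ℂ) 𝓘(ℝ, ℝ) ∞ f) {z : ℂ} (hz : z ∈ e.target) :
    ContDiffAt ℝ ∞ (f ∘ e.symm) z := by
  have h1 : ContMDiffOn 𝓘(ℝ, ℂ) 𝓘(ℝ, ℂ) ∞ e.symm e.target :=
    contMDiffOn_symm_of_mem_maximalAtlas (IsManifold.subset_maximalAtlas he)
  have h2 : ContMDiffAt 𝓘(ℝ, ℂ) 𝓘(ℝ, ℝ) ∞ (f ∘ e.symm) z :=
    (hf.contMDiffAt).comp z (h1.contMDiffAt (e.open_target.mem_nhds hz))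
  exact contMDiffAt_iff_contDiffAt.1 h2

theorem continuousAt_laplacian {h : ℂ → ℝ} {z : ℂ} (hh : ContDiffAt ℝ ∞ h z) :
    ContinuousAt (Δ h) z := by
  have h2 : ContinuousAt (iteratedFDeriv ℝ 2 h) z :=
    (hh.iteratedFDeriv_right (m := 0) (i := 2) (by simpa using two_le_infty)).continuousAt
  rw [laplacian_eq_iteratedFDeriv_complexPlane]
  exact (h2.eval_const _).add (h2.eval_const _)

end

namespace ConformalMetric

variable {X : Type*} [TopologicalSpace X] [ChartedSpace ℂ X] [IsManifold 𝓘(ℂ) ω X]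
  (g : ConformalMetric X) {e : OpenPartialHomeomorph X ℂ}

/-- The Laplacian `ρ⁻¹ (∂²f/∂x² + ∂²f/∂y²)` of a function on the surface, with the sign for which
it is nonnegative at a minimum, computed at `x` in the chart preferred at `x`. -/
def surfaceLaplacian (f : X → ℝ) (x : X) : ℝ :=
  (g.factor x)⁻¹ * Δ (f ∘ (chartAt ℂ x).symm) (chartAt ℂ x x)

theorem density_mul_surfaceLaplacian (he : e ∈ atlas ℂ X) {f : X → ℝ}
    (hf : ContMDiff 𝓘(ℝ, ℂ) 𝓘(ℝ, ℝ) ∞ f) {z : ℂ} (hz : z ∈ e.target) :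
    g.density e z * g.surfaceLaplacian f (e.symm z) = Δ (f ∘ e.symm) z := by
  set x := e.symm z
  have hx : x ∈ e.source := e.map_target hz
  have hex : e x = z := e.right_inv hz
  set c := chartAt ℂ x
  have hc : c ∈ atlas ℂ X := chart_mem_atlas ℂ x
  have hxc : x ∈ c.source := mem_chart_source ℂ x
  have h1 : f ∘ e.symm =ᶠ[𝓝 z] (f ∘ c.symm) ∘ (c ∘ e.symm) := by
    have : e.symm ⁻¹' c.source ∈ 𝓝 z :=
      (e.continuousAt_symm hz).preimage_mem_nhds (c.open_source.mem_nhds hxc)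
    filter_upwards [this] with w hw
    simp [c.left_inv hw]
  have ha := analyticAt_coordChange he hc hx hxc
  rw [hex] at ha
  have h2 : ContDiffAt ℝ 2 (f ∘ c.symm) ((c ∘ e.symm) z) :=
    (contDiffAt_comp_chart_symm hc hf (c.map_source hxc)).of_le two_le_infty
  have h3 : chartDeriv e x = deriv (c ∘ e.symm) z := by rw [chartDeriv, hex]
  rw [(laplacian_congr_nhds h1).eq_of_nhds, laplacian_comp_holomorphic ha h2, g.density_eq he hz,
    h3, surfaceLaplacian]
  have := (g.factor_pos x).ne'
  change ‖deriv (c ∘ e.symm) z‖ ^ 2 * g.factor x * ((g.factor x)⁻¹ * Δ (f ∘ c.symm) (c x)) =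
    ‖deriv (c ∘ e.symm) z‖ ^ 2 * Δ (f ∘ c.symm) (c x)
  field_simp

theorem continuous_surfaceLaplacian {f : X → ℝ} (hf : ContMDiff 𝓘(ℝ, ℂ) 𝓘(ℝ, ℝ) ∞ f) :
    Continuous (g.surfaceLaplacian f) := by
  refine continuous_iff_continuousAt.2 fun x => ?_
  have he := chart_mem_atlas ℂ x
  set e := chartAt ℂ x
  have hx : x ∈ e.source := mem_chart_source ℂ x
  have hz : e x ∈ e.target := e.map_source hx
  have h1 : ContinuousAt (fun y => (g.density e (e y))⁻¹ * Δ (f ∘ e.symm) (e y)) x := by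
    refine ContinuousAt.mul (ContinuousAt.inv₀ ?_ (g.density_pos he hz).ne') ?_
    · exact ContinuousAt.comp (g := g.density e)
        ((g.continuousOn_density he).continuousAt (e.open_target.mem_nhds hz)) (e.continuousAt hx)
    · exact ContinuousAt.comp (g := Δ (f ∘ e.symm))
        (continuousAt_laplacian (contDiffAt_comp_chart_symm he hf hz)) (e.continuousAt hx)
  refine h1.congr ?_
  filter_upwards [e.open_source.mem_nhds hx] with y hy
  rw [← g.density_mul_surfaceLaplacian he hf (e.map_source hy), e.left_inv hy,
    inv_mul_cancel_left₀ (g.density_pos he (e.map_source hy)).ne']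

theorem surfaceLaplacian_eq_zero_of_notMem_tsupport {f : X → ℝ} {x : X} (hx : x ∉ tsupport f) :
    g.surfaceLaplacian f x = 0 := by
  have h1 : f =ᶠ[𝓝 x] 0 := notMem_tsupport_iff_eventuallyEq.1 hx
  have h2 : f ∘ (chartAt ℂ x).symm =ᶠ[𝓝 (chartAt ℂ x x)] fun _ => (0 : ℝ) := by
    have hc := (chartAt ℂ x).continuousAt_symm (mem_chart_target ℂ x)
    rw [ContinuousAt, (chartAt ℂ x).left_inv (mem_chart_source ℂ x)] at hc
    exact hc.eventually h1
  rw [surfaceLaplacian, (laplacian_congr_nhds h2).eq_of_nhds]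
  simp

theorem surfaceLaplacian_sum {ι : Type*} (s : Finset ι) {f : ι → X → ℝ}
    (hf : ∀ i ∈ s, ContMDiff 𝓘(ℝ, ℂ) 𝓘(ℝ, ℝ) ∞ (f i)) (x : X) :
    g.surfaceLaplacian (fun y => ∑ i ∈ s, f i y) x = ∑ i ∈ s, g.surfaceLaplacian (f i) x := by
  classical
  induction s using Finset.induction_on with
  | empty => exact g.surfaceLaplacian_eq_zero_of_notMem_tsupport (by simp)
  | insert i s hi ih =>
    have hs : ContMDiff 𝓘(ℝ, ℂ) 𝓘(ℝ, ℝ) ∞ fun y => ∑ j ∈ s, f j y :=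
      ContMDiff.sum fun j hj => hf j (Finset.mem_insert_of_mem hj)
    rw [Finset.sum_insert hi, ← ih fun j hj => hf j (Finset.mem_insert_of_mem hj)]
    simp only [surfaceLaplacian]
    rw [← mul_add, ← ContDiffAt.laplacian_add]
    · congr 2
      exact congrFun (congrArg _ (funext fun z => by simp [Finset.sum_insert hi])) _
    · exact (contDiffAt_comp_chart_symm (chart_mem_atlas ℂ x)
        (hf i (Finset.mem_insert_self i s)) (mem_chart_target ℂ x)).of_le two_le_infty
    · exact (contDiffAt_comp_chart_symm (chart_mem_atlas ℂ x) hs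
        (mem_chart_target ℂ x)).of_le two_le_infty

variable [MeasurableSpace X] [BorelSpace X] [CompactSpace X]

theorem integral_surfaceLaplacian_of_tsupport_subset (he : e ∈ atlas ℂ X) {f : X → ℝ}
    (hf : ContMDiff 𝓘(ℝ, ℂ) 𝓘(ℝ, ℝ) ∞ f) (hs : tsupport f ⊆ e.source) :
    ∫ x, g.surfaceLaplacian f x ∂g.area = 0 := by
  classical
  -- the function in the coordinate, extended by zero
  set h : ℂ → ℝ := e.target.indicator (f ∘ e.symm) with hh
  set K := e '' tsupport f with hK
  have hKc : IsCompact K :=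
    (isClosed_tsupport f).isCompact.image_of_continuousOn (e.continuousOn.mono hs)
  have hKt : K ⊆ e.target := by
    rintro _ ⟨x, hx, rfl⟩; exact e.map_source (hs hx)
  have hout : ∀ z ∉ K, h z = 0 := fun z hz => by
    by_cases hzt : z ∈ e.target
    · rw [hh, Set.indicator_of_mem hzt]
      exact image_eq_zero_of_notMem_tsupport (f := f) fun hx => hz ⟨_, hx, e.right_inv hzt⟩
    · rw [hh, Set.indicator_of_notMem hzt]
  have hin : ∀ z ∈ e.target, h =ᶠ[𝓝 z] f ∘ e.symm := fun z hz => by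
    filter_upwards [e.open_target.mem_nhds hz] with w hw
    rw [hh, Set.indicator_of_mem hw]
  have hzero : ∀ z ∉ K, h =ᶠ[𝓝 z] fun _ => 0 := fun z hz => by
    filter_upwards [hKc.isClosed.isOpen_compl.mem_nhds hz] with w hw using hout w hw
  have hsm : ContDiff ℝ ∞ h := by
    refine contDiff_iff_contDiffAt.2 fun z => ?_
    by_cases hz : z ∈ e.target
    · exact (contDiffAt_comp_chart_symm he hf hz).congr_of_eventuallyEq (hin z hz)
    · exact contDiffAt_const.congr_of_eventuallyEq (hzero z fun h => hz (hKt h))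
  have hc : HasCompactSupport h := HasCompactSupport.intro hKc hout
  have h1 : ∫ x, g.surfaceLaplacian f x ∂g.area =
      ∫ x in e.source, g.surfaceLaplacian f x ∂g.area :=
    (setIntegral_eq_integral_of_forall_compl_eq_zero fun x hx =>
      g.surfaceLaplacian_eq_zero_of_notMem_tsupport fun h => hx (hs h)).symm
  have h2 : ∫ z in e.target, Δ h z = ∫ z, Δ h z :=
    setIntegral_eq_integral_of_forall_compl_eq_zero fun z hz => by
      rw [(laplacian_congr_nhds (hzero z fun h => hz (hKt h))).eq_of_nhds]
      simp
  rw [h1, g.setIntegral_source he (g.continuous_surfaceLaplacian hf),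
    ← integral_laplacian_eq_zero (hsm.of_le two_le_infty) hc, ← h2]
  refine setIntegral_congr_fun e.open_target.measurableSet fun z hz => ?_
  rw [g.density_mul_surfaceLaplacian he hf hz, (laplacian_congr_nhds (hin z hz)).eq_of_nhds]

variable [T2Space X]

/-- The divergence theorem for gradients: the Laplacian of a smooth function on a closed surface has
integral zero. -/
theorem integral_surfaceLaplacian {f : X → ℝ} (hf : ContMDiff 𝓘(ℝ, ℂ) 𝓘(ℝ, ℝ) ∞ f) :
    ∫ x, g.surfaceLaplacian f x ∂g.area = 0 := by
  classical
  obtain ⟨p, hp⟩ := SmoothPartitionOfUnity.exists_isSubordinate 𝓘(ℝ, ℂ) (M := X) isClosed_univ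
    (fun x : X => (chartAt ℂ x).source) (fun x => (chartAt ℂ x).open_source)
    (fun x _ => Set.mem_iUnion.2 ⟨x, mem_chart_source ℂ x⟩)
  have hfin : {i | (Function.support (p i)).Nonempty}.Finite :=
    p.locallyFinite.finite_nonempty_of_compact
  set s := hfin.toFinset
  have hsum : f = fun y => ∑ i ∈ s, p i y * f y := by
    ext y
    rw [← Finset.sum_mul, ← finsum_eq_sum_of_support_subset, p.sum_eq_one (Set.mem_univ y), one_mul]
    intro i hi
    simp only [s, Set.Finite.coe_toFinset, Set.mem_ofPred_eq]
    exact ⟨y, fun h => hi (by simpa using h)⟩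
  have hsm (i : X) : ContMDiff 𝓘(ℝ, ℂ) 𝓘(ℝ, ℝ) ∞ fun y => p i y * f y :=
    (p i).contMDiff.mul hf
  have h1 : g.surfaceLaplacian f = fun x =>
      ∑ i ∈ s, g.surfaceLaplacian (fun y => p i y * f y) x := by
    ext x
    conv_lhs => rw [hsum]
    exact g.surfaceLaplacian_sum s (fun i _ => hsm i) x
  rw [h1, integral_finsetSum]
  · refine Finset.sum_eq_zero fun i _ => ?_
    exact g.integral_surfaceLaplacian_of_tsupport_subset (chart_mem_atlas ℂ i) (hsm i)
      ((tsupport_mul_subset_left).trans (hp i))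
  · exact fun i _ => (g.continuous_surfaceLaplacian (hsm i)).integrable_of_hasCompactSupport
      (HasCompactSupport.of_compactSpace _)

end ConformalMetric

end HiggsBundle

/-! ### Endomorphisms of a Hermitian vector space -/

namespace HiggsBundle

section LinearAlgebra

/-- The trace of a complex linear map, seen as a real linear map. -/
theorem trace_restrictScalars_eq_two_mul_re {V : Type*} [AddCommGroup V] [Module ℂ V] [Module ℝ V]
    [IsScalarTower ℝ ℂ V] [FiniteDimensional ℂ V] (a : V →ₗ[ℂ] V) :
    LinearMap.trace ℝ V (a.restrictScalars ℝ) = 2 * (LinearMap.trace ℂ V a).re := by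
  classical
  set b := Module.finBasis ℂ V
  set c := Complex.basisOneI.smulTower b with hc
  rw [LinearMap.trace_eq_matrix_trace ℝ c, LinearMap.trace_eq_matrix_trace ℂ b]
  simp only [Matrix.trace, Matrix.diag, LinearMap.toMatrix_apply, Complex.re_sum]
  rw [Fintype.sum_prod_type, Fin.sum_univ_two, two_mul]
  congr 1
  · refine Finset.sum_congr rfl fun i _ => ?_
    simp [hc, Module.Basis.smulTower_repr, Module.Basis.smulTower_apply]
  · refine Finset.sum_congr rfl fun i _ => ?_
    simp [hc, Module.Basis.smulTower_repr, Module.Basis.smulTower_apply]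

variable {V : Type*} [NormedAddCommGroup V] [InnerProductSpace ℂ V]

theorem endTrace_add (a b : V →L[ℂ] V) : endTrace (a + b) = endTrace a + endTrace b :=
  map_add (LinearMap.trace ℂ V) _ _

theorem endTrace_sub (a b : V →L[ℂ] V) : endTrace (a - b) = endTrace a - endTrace b :=
  map_sub (LinearMap.trace ℂ V) _ _

theorem endTrace_smul (c : ℂ) (a : V →L[ℂ] V) : endTrace (c • a) = c * endTrace a :=
  map_smul (LinearMap.trace ℂ V) c _

theorem endTrace_mul_comm (a b : V →L[ℂ] V) : endTrace (a * b) = endTrace (b * a) :=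
  LinearMap.trace_mul_comm ℂ (a : V →ₗ[ℂ] V) (b : V →ₗ[ℂ] V)

variable [FiniteDimensional ℂ V]

theorem inner_endAdjoint_right (a : V →L[ℂ] V) (v w : V) :
    inner ℂ v (endAdjoint a w) = inner ℂ (a v) w :=
  LinearMap.adjoint_inner_right (a : V →ₗ[ℂ] V) v w

theorem eq_endAdjoint_iff (a b : V →L[ℂ] V) :
    a = endAdjoint b ↔ ∀ v w, inner ℂ v (a w) = inner ℂ (b v) w := by
  constructor
  · rintro rfl v w; exact inner_endAdjoint_right b v w
  · intro h
    ext w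
    exact ext_inner_left ℂ fun v => by rw [h, inner_endAdjoint_right]

theorem endAdjoint_endAdjoint (a : V →L[ℂ] V) : endAdjoint (endAdjoint a) = a := by
  refine ((eq_endAdjoint_iff _ _).2 fun v w => ?_).symm
  rw [← inner_conj_symm, ← inner_endAdjoint_right, inner_conj_symm]

theorem endAdjoint_mul (a b : V →L[ℂ] V) : endAdjoint (a * b) = endAdjoint b * endAdjoint a := by
  refine ((eq_endAdjoint_iff _ _).2 fun v w => ?_).symm
  simp only [mul_apply_eq_comp, inner_endAdjoint_right]

theorem endAdjoint_sub (a b : V →L[ℂ] V) : endAdjoint (a - b) = endAdjoint a - endAdjoint b := by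
  refine ((eq_endAdjoint_iff _ _).2 fun v w => ?_).symm
  simp only [sub_apply, inner_sub_left, inner_sub_right, inner_endAdjoint_right]

theorem endAdjoint_I_smul (a : V →L[ℂ] V) :
    endAdjoint (Complex.I • a) = -(Complex.I • endAdjoint a) := by
  refine ((eq_endAdjoint_iff _ _).2 fun v w => ?_).symm
  simp [inner_smul_right, inner_endAdjoint_right, mul_comm]

theorem endAdjoint_add (a b : V →L[ℂ] V) : endAdjoint (a + b) = endAdjoint a + endAdjoint b := by
  refine ((eq_endAdjoint_iff _ _).2 fun v w => ?_).symm
  simp only [add_apply, inner_add_left, inner_add_right, inner_endAdjoint_right]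

theorem endAdjoint_real_smul (r : ℝ) (a : V →L[ℂ] V) :
    endAdjoint (r • a) = r • endAdjoint a := by
  refine ((eq_endAdjoint_iff _ _).2 fun v w => ?_).symm
  change inner ℂ v ((r : ℂ) • endAdjoint a w) = inner ℂ ((r : ℂ) • a v) w
  rw [inner_smul_left, inner_smul_right, inner_endAdjoint_right, Complex.conj_ofReal]

theorem endAdjoint_eq_self {a : V →L[ℂ] V} (ha : (a : V →ₗ[ℂ] V).IsSymmetric) :
    endAdjoint a = a :=
  ((eq_endAdjoint_iff _ _).2 fun v w => (ha v w).symm).symm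

theorem endTrace_endAdjoint (a : V →L[ℂ] V) : endTrace (endAdjoint a) = star (endTrace a) := by
  have h := LinearMap.trace_eq_sum_inner (endAdjoint a : V →ₗ[ℂ] V) (stdOrthonormalBasis ℂ V)
  have h' := LinearMap.trace_eq_sum_inner (a : V →ₗ[ℂ] V) (stdOrthonormalBasis ℂ V)
  rw [endTrace, endTrace, h, h', star_sum]
  refine Finset.sum_congr rfl fun i _ => ?_
  exact (inner_endAdjoint_right a _ _).trans (inner_conj_symm _ _).symm

theorem endInner_self (a : V →L[ℂ] V) : endInner a a = (endNormSq a : ℂ) := by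
  have h : star (endInner a a) = endInner a a := by
    rw [endInner, ← endTrace_endAdjoint, endAdjoint_mul, endAdjoint_endAdjoint]
  exact (Complex.conj_eq_iff_re.1 h).symm

theorem endNormSq_eq_sum (a : V →L[ℂ] V) :
    endNormSq a = ∑ i, ‖endAdjoint a (stdOrthonormalBasis ℂ V i)‖ ^ 2 := by
  have h := LinearMap.trace_eq_sum_inner ((a * endAdjoint a : V →L[ℂ] V) : V →ₗ[ℂ] V)
    (stdOrthonormalBasis ℂ V)
  rw [endNormSq, endInner, endTrace, h, Complex.re_sum]
  refine Finset.sum_congr rfl fun i _ => ?_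
  change (inner ℂ _ (a (endAdjoint a _))).re = _
  have h2 := inner_endAdjoint_right (endAdjoint a) (stdOrthonormalBasis ℂ V i)
    (endAdjoint a (stdOrthonormalBasis ℂ V i))
  rw [endAdjoint_endAdjoint] at h2
  rw [h2]
  exact inner_self_eq_norm_sq (𝕜 := ℂ) _

theorem endNormSq_nonneg (a : V →L[ℂ] V) : 0 ≤ endNormSq a := by
  rw [endNormSq_eq_sum]
  positivity

theorem endNormSq_eq_zero {a : V →L[ℂ] V} (h : endNormSq a = 0) : a = 0 := by
  rw [endNormSq_eq_sum, Finset.sum_eq_zero_iff_of_nonneg fun i _ => by positivity] at h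
  have h1 : endAdjoint a = 0 := by
    have h2 : (endAdjoint a : V →ₗ[ℂ] V) = 0 :=
      (stdOrthonormalBasis ℂ V).toBasis.ext fun i => by
        simpa using h i (Finset.mem_univ i)
    ext w
    exact congrArg (fun L : V →ₗ[ℂ] V => L w) h2
  rw [← endAdjoint_endAdjoint a, h1]
  ext w
  refine ext_inner_left ℂ fun v => ?_
  rw [inner_endAdjoint_right]
  simp

theorem endNormSq_I_smul (a : V →L[ℂ] V) : endNormSq (Complex.I • a) = endNormSq a := by
  rw [endNormSq, endNormSq, endInner, endInner, endAdjoint_I_smul]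
  congr 2
  rw [mul_neg, smul_mul_smul_comm, Complex.I_mul_I]
  simp

/-- The square norm is a quadratic form for which multiplication by `c` in the plane spanned by two
endomorphisms is a similarity. -/
theorem endNormSq_rotate (a b : V →L[ℂ] V) (c : ℂ) :
    endNormSq (c.re • a + c.im • b) + endNormSq (c.re • b - c.im • a) =
      ‖c‖ ^ 2 * (endNormSq a + endNormSq b) := by
  have hs (r : ℝ) (d : V →L[ℂ] V) : (endTrace (r • d)).re = r * (endTrace d).re := by
    change (endTrace ((r : ℂ) • d)).re = _
    rw [endTrace_smul, Complex.re_ofReal_mul]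
  simp only [endNormSq, endInner, endAdjoint_add, endAdjoint_sub, endAdjoint_real_smul, mul_add,
    mul_sub, add_mul, sub_mul, smul_mul_smul_comm, endTrace_add, endTrace_sub, Complex.add_re,
    Complex.sub_re, hs]
  rw [← Complex.normSq_eq_norm_sq, Complex.normSq_apply]
  ring

/-- If `γ` is Hermitian, then `⁅φ, γ⁆* = -⁅φ*, γ⁆`. -/
theorem endAdjoint_lie {φ γ : V →L[ℂ] V} (hγ : endAdjoint γ = γ) :
    endAdjoint ⁅φ, γ⁆ = -⁅endAdjoint φ, γ⁆ := by
  rw [Ring.lie_def, Ring.lie_def, endAdjoint_sub, endAdjoint_mul, endAdjoint_mul, hγ, neg_sub]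

/-- By the cyclic symmetry of the trace, `ad φ*` is minus the adjoint of `ad φ`. -/
theorem endTrace_lie_lie {φ γ : V →L[ℂ] V} (hγ : endAdjoint γ = γ) :
    endTrace ((⁅endAdjoint φ, ⁅φ, γ⁆⁆ + ⁅φ, ⁅endAdjoint φ, γ⁆⁆) * γ) =
      2 * endNormSq ⁅φ, γ⁆ := by
  rw [← endInner_self, endInner, endAdjoint_lie hγ]
  set ψ := endAdjoint φ
  have e1 : (⁅ψ, ⁅φ, γ⁆⁆ + ⁅φ, ⁅ψ, γ⁆⁆) * γ =
      (ψ * (φ * γ * γ) - ψ * (γ * φ * γ) - φ * γ * (ψ * γ) + γ * (φ * ψ * γ)) +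
      (φ * ψ * γ * γ - φ * γ * (ψ * γ) - ψ * (γ * φ * γ) + γ * (ψ * φ * γ)) := by
    simp only [Ring.lie_def]
    noncomm_ring
  have e2 : ⁅φ, γ⁆ * -⁅ψ, γ⁆ =
      φ * γ * γ * ψ - φ * γ * (ψ * γ) - γ * φ * γ * ψ + γ * (φ * ψ * γ) := by
    simp only [Ring.lie_def]
    noncomm_ring
  have c1 : endTrace (φ * γ * γ * ψ) = endTrace (ψ * (φ * γ * γ)) := endTrace_mul_comm _ _
  have c2 : endTrace (γ * φ * γ * ψ) = endTrace (ψ * (γ * φ * γ)) := endTrace_mul_comm _ _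
  have c3 : endTrace (φ * ψ * γ * γ) = endTrace (γ * (φ * ψ * γ)) := endTrace_mul_comm _ _
  have c4 : endTrace (γ * (ψ * φ * γ)) = endTrace (ψ * (φ * γ * γ)) := by
    rw [endTrace_mul_comm]; congr 1
  rw [e1, e2]
  simp only [endTrace_add, endTrace_sub, c1, c2, c3, c4]
  ring

end LinearAlgebra

end HiggsBundle

/-! ### Sections and connections in a local trivialization -/

namespace HiggsBundle

open Topology Filter

section LocalTrivialization

variable {X : Type*} [TopologicalSpace X] (F : Type*) [NormedAddCommGroup F]
  {E : X → Type*} [TopologicalSpace (TotalSpace F E)] [∀ x, NormedAddCommGroup (E x)]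
  [FiberBundle F E]

variable {F} in
theorem eventually_mem_baseSet (x₀ : X) : ∀ᶠ y in 𝓝 x₀, y ∈ (trivializationAt F E x₀).baseSet :=
  (trivializationAt F E x₀).open_baseSet.mem_nhds (FiberBundle.mem_baseSet_trivializationAt' x₀)

variable [NormedSpace ℂ F] [∀ x, InnerProductSpace ℂ (E x)] [VectorBundle ℝ F E]

/-- The identification of the fibre at `y` with the fibre at `x₀` given by the trivialization of `E`
preferred at `x₀`; it is meaningful for `y` in the base set of this trivialization. -/
def toFiber (x₀ y : X) : E y →L[ℝ] E x₀ :=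
  ((trivializationAt F E x₀).symmL ℝ x₀).comp ((trivializationAt F E x₀).continuousLinearMapAt ℝ y)

/-- The inverse of `toFiber F x₀ y`. -/
def ofFiber (x₀ y : X) : E x₀ →L[ℝ] E y :=
  ((trivializationAt F E x₀).symmL ℝ y).comp ((trivializationAt F E x₀).continuousLinearMapAt ℝ x₀)

variable {F}

theorem ofFiber_toFiber {x₀ y : X} (hy : y ∈ (trivializationAt F E x₀).baseSet) (v : E y) :
    ofFiber F x₀ y (toFiber F x₀ y v) = v := by
  have h := FiberBundle.mem_baseSet_trivializationAt' (F := F) (E := E) x₀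
  simp only [ofFiber, toFiber, ContinuousLinearMap.comp_apply]
  rw [Trivialization.continuousLinearMapAt_symmL _ h,
    Trivialization.symmL_continuousLinearMapAt _ hy]

theorem toFiber_ofFiber {x₀ y : X} (hy : y ∈ (trivializationAt F E x₀).baseSet) (v : E x₀) :
    toFiber F x₀ y (ofFiber F x₀ y v) = v := by
  have h := FiberBundle.mem_baseSet_trivializationAt' (F := F) (E := E) x₀
  simp only [ofFiber, toFiber, ContinuousLinearMap.comp_apply]
  rw [Trivialization.continuousLinearMapAt_symmL _ hy,
    Trivialization.symmL_continuousLinearMapAt _ h]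

theorem toFiber_self (x₀ : X) (v : E x₀) : toFiber F x₀ x₀ v = v :=
  Trivialization.symmL_continuousLinearMapAt _ (FiberBundle.mem_baseSet_trivializationAt' x₀) v

theorem ofFiber_eq_extend {x₀ y : X} (hy : y ∈ (trivializationAt F E x₀).baseSet) (v : E x₀) :
    ofFiber F x₀ y v = FiberBundle.extend F v y := by
  simp only [ofFiber, ContinuousLinearMap.comp_apply]
  rw [Trivialization.symmL_apply (R := ℝ) _ hy,
    Trivialization.continuousLinearMapAt_apply_of_mem _ _
    (FiberBundle.mem_baseSet_trivializationAt' x₀)]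
  rfl

theorem toFiber_extend {x₀ y : X} (hy : y ∈ (trivializationAt F E x₀).baseSet) (v : E x₀) :
    toFiber F x₀ y (FiberBundle.extend F v y) = v := by
  rw [← ofFiber_eq_extend hy, toFiber_ofFiber hy]

variable [ChartedSpace ℂ X]

variable (F) in
/-- The section `σ` of `E` is differentiable at `x`. -/
abbrev SectionDiffAt (σ : ∀ x, E x) (x : X) : Prop :=
  MDifferentiableAt 𝓘(ℝ, ℂ) (𝓘(ℝ, ℂ).prod 𝓘(ℝ, F)) (fun y => TotalSpace.mk' F y (σ y)) x

variable (F) in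
/-- The section `a` of `Hom(E, E)` is differentiable at `x`. -/
abbrev EndDiffAt (a : ∀ x, E x →L[ℂ] E x) (x : X) : Prop :=
  MDifferentiableAt 𝓘(ℝ, ℂ) (𝓘(ℝ, ℂ).prod 𝓘(ℝ, F →L[ℝ] F)) (endSection F a) x

theorem sectionDiffAt_extend [ContMDiffVectorBundle ∞ F E 𝓘(ℝ, ℂ)] {x₀ : X} (v : E x₀) :
    SectionDiffAt F (FiberBundle.extend F v) x₀ :=
  haveI : ContMDiffVectorBundle 1 F E 𝓘(ℝ, ℂ) := .of_le (n := ∞) (by simp)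
  FiberBundle.mdifferentiableAt_extend ..

/-- A section is `C^n` at `x₀` if and only if its components in a trivialization are. -/
theorem contMDiffAt_section_iff_toFiber {σ : ∀ x, E x} {x₀ : X} {n : ℕ∞ω} :
    ContMDiffAt 𝓘(ℝ, ℂ) (𝓘(ℝ, ℂ).prod 𝓘(ℝ, F)) n (fun y => TotalSpace.mk' F y (σ y)) x₀ ↔
    ContMDiffAt 𝓘(ℝ, ℂ) 𝓘(ℝ, E x₀) n (fun y => toFiber F x₀ y (σ y)) x₀ := by
  rw [contMDiffAt_section]
  have h0 := FiberBundle.mem_baseSet_trivializationAt' (F := F) (E := E) x₀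
  constructor
  · intro h
    refine (((trivializationAt F E x₀).symmL ℝ x₀).contMDiff.contMDiffAt.comp x₀
      h).congr_of_eventuallyEq ?_
    filter_upwards [eventually_mem_baseSet (F := F) (E := E) x₀] with y hy
    simp [toFiber, Trivialization.continuousLinearMapAt_apply_of_mem _ _ hy]
  · intro h
    refine (((trivializationAt F E x₀).continuousLinearMapAt ℝ x₀).contMDiff.contMDiffAt.comp x₀
      h).congr_of_eventuallyEq ?_
    filter_upwards [eventually_mem_baseSet (F := F) (E := E) x₀] with y hy
    simp only [toFiber, Function.comp_apply, ContinuousLinearMap.comp_apply]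
    rw [Trivialization.continuousLinearMapAt_symmL _ h0,
      Trivialization.continuousLinearMapAt_apply_of_mem _ _ hy]

theorem mdifferentiableAt_section_iff_toFiber {σ : ∀ x, E x} {x₀ : X} :
    SectionDiffAt F σ x₀ ↔
    MDifferentiableAt 𝓘(ℝ, ℂ) 𝓘(ℝ, E x₀) (fun y => toFiber F x₀ y (σ y)) x₀ := by
  rw [SectionDiffAt, mdifferentiableAt_section]
  have h0 := FiberBundle.mem_baseSet_trivializationAt' (F := F) (E := E) x₀
  constructor
  · intro h
    refine (((trivializationAt F E x₀).symmL ℝ x₀).mdifferentiableAt.comp x₀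
      h).congr_of_eventuallyEq ?_
    filter_upwards [eventually_mem_baseSet (F := F) (E := E) x₀] with y hy
    simp [toFiber, Trivialization.continuousLinearMapAt_apply_of_mem _ _ hy]
  · intro h
    refine (((trivializationAt F E x₀).continuousLinearMapAt ℝ x₀).mdifferentiableAt.comp x₀
      h).congr_of_eventuallyEq ?_
    filter_upwards [eventually_mem_baseSet (F := F) (E := E) x₀] with y hy
    simp only [toFiber, Function.comp_apply, ContinuousLinearMap.comp_apply]
    rw [Trivialization.continuousLinearMapAt_symmL _ h0,
      Trivialization.continuousLinearMapAt_apply_of_mem _ _ hy]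

variable [FiniteDimensional ℂ F]

/-- A family of linear maps between finite dimensional spaces is differentiable if it is so
pointwise. -/
theorem mdifferentiableAt_clm_of_apply {G : Type*} [NormedAddCommGroup G] [NormedSpace ℝ G]
    [FiniteDimensional ℝ G] {f : X → G →L[ℝ] G} {x : X}
    (h : ∀ v, MDifferentiableAt 𝓘(ℝ, ℂ) 𝓘(ℝ, G) (fun y => f y v) x) :
    MDifferentiableAt 𝓘(ℝ, ℂ) 𝓘(ℝ, G →L[ℝ] G) f x := by
  set b := Module.finBasis ℝ G
  let L (i) : G →L[ℝ] (G →L[ℝ] G) :=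
    ContinuousLinearMap.smulRightL ℝ G G (LinearMap.toContinuousLinearMap (b.coord i))
  have h1 : f = fun y => ∑ i, L i (f y (b i)) := by
    funext y
    ext v
    conv_lhs => rw [← b.sum_repr v, map_sum]
    simp [L]
  rw [h1]
  have h2 := MDifferentiableAt.sum (I := 𝓘(ℝ, ℂ)) (t := Finset.univ) (z := x)
    fun i _ => (L i).mdifferentiableAt.comp x (h (b i))
  exact h2.congr_of_eventuallyEq (.of_forall fun y => by simp)

/-- A section of `Hom(E, E)` is differentiable if it maps local sections which are constant in a
trivialization to differentiable sections. -/
theorem endDiffAt_of_extend {a : ∀ x, E x →L[ℂ] E x} {x₀ : X}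
    (h : ∀ v : E x₀, SectionDiffAt F (fun y => a y (FiberBundle.extend F v y)) x₀) :
    EndDiffAt F a x₀ := by
  refine (mdifferentiableAt_hom_bundle _).2 ⟨mdifferentiableAt_id, ?_⟩
  have h0 := FiberBundle.mem_baseSet_trivializationAt' (F := F) (E := E) x₀
  have : FiniteDimensional ℝ F := FiniteDimensional.complexToReal F
  refine mdifferentiableAt_clm_of_apply fun w => ?_
  refine ((mdifferentiableAt_section _ _).1
    (h ((trivializationAt F E x₀).symmL ℝ x₀ w))).congr_of_eventuallyEq ?_
  filter_upwards [eventually_mem_baseSet (F := F) (E := E) x₀] with y hy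
  have h1 : FiberBundle.extend F ((trivializationAt F E x₀).symmL ℝ x₀ w) y =
      (trivializationAt F E x₀).symmL ℝ y w := by
    rw [← ofFiber_eq_extend hy, ofFiber, ContinuousLinearMap.comp_apply,
      Trivialization.continuousLinearMapAt_symmL _ h0]
  have h2 := Trivialization.continuousLinearMapAt_apply_of_mem (R := ℝ) (trivializationAt F E x₀)
    hy (a y ((trivializationAt F E x₀).symmL ℝ y w))
  rw [h1, ← h2]
  rfl

end LocalTrivialization

end HiggsBundle

/-! ### The induced connection on endomorphisms -/

namespace HiggsBundle

open Topology Filter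

section Connection

theorem mdifferentiableAt_sum_clm {X : Type*} [TopologicalSpace X] [ChartedSpace ℂ X]
    {G H : Type*} [NormedAddCommGroup G] [NormedSpace ℝ G] [NormedAddCommGroup H] [NormedSpace ℝ H]
    {n : ℕ} (c : Fin n → G →L[ℝ] H) {f : Fin n → X → G} {x : X}
    (hf : ∀ j, MDifferentiableAt 𝓘(ℝ, ℂ) 𝓘(ℝ, G) (f j) x) :
    MDifferentiableAt 𝓘(ℝ, ℂ) 𝓘(ℝ, H) (fun y => ∑ j, c j (f j y)) x ∧
    ∀ v, mvfderiv 𝓘(ℝ, ℂ) (fun y => ∑ j, c j (f j y)) x v =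
      ∑ j, c j (mvfderiv 𝓘(ℝ, ℂ) (f j) x v) := by
  have h1 : (∑ j, ⇑(c j) ∘ f j) = fun y => ∑ j, c j (f j y) := by
    funext y
    simp
  have h : HasMFDerivAt 𝓘(ℝ, ℂ) 𝓘(ℝ, H) (∑ j, ⇑(c j) ∘ f j) x
      (∑ j, (c j).comp (mvfderiv 𝓘(ℝ, ℂ) (f j) x)) :=
    HasMFDerivAt.sum fun j _ => (c j).hasMFDerivAt.comp x (hf j).hasMFDerivAt
  rw [h1] at h
  refine ⟨h.mdifferentiableAt, fun v => ?_⟩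
  have h2 : mvfderiv 𝓘(ℝ, ℂ) (fun y => ∑ j, c j (f j y)) x =
      ∑ j, (c j).comp (mvfderiv 𝓘(ℝ, ℂ) (f j) x) := h.mfderiv
  rw [h2]
  simp

variable {X : Type*} [TopologicalSpace X] [ChartedSpace ℂ X] [IsManifold 𝓘(ℂ) ω X]
  {F : Type*} [NormedAddCommGroup F] [NormedSpace ℂ F]
  {E : X → Type*} [TopologicalSpace (TotalSpace F E)]
  [∀ x, NormedAddCommGroup (E x)] [∀ x, InnerProductSpace ℂ (E x)]
  [FiberBundle F E] [VectorBundle ℂ F E] [VectorBundle ℝ F E]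
  [FiniteDimensional ℂ F] [ContMDiffVectorBundle ∞ F E 𝓘(ℝ, ℂ)]
  [IsContMDiffRiemannianBundle 𝓘(ℝ, ℂ) ∞ F E]

set_option linter.unusedSectionVars false

open UnitaryConnection

theorem endDiffAt_mul {a b : ∀ x, E x →L[ℂ] E x} {x : X} (ha : EndDiffAt F a x)
    (hb : EndDiffAt F b x) : EndDiffAt F (fun y => a y * b y) x :=
  endDiffAt_of_extend fun v =>
    mdifferentiableAt_end_apply ha (mdifferentiableAt_end_apply hb (sectionDiffAt_extend v))

theorem endDiffAt_sub {a b : ∀ x, E x →L[ℂ] E x} {x : X} (ha : EndDiffAt F a x)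
    (hb : EndDiffAt F b x) : EndDiffAt F (fun y => a y - b y) x :=
  endDiffAt_of_extend fun v => mdifferentiableAt_sub_section
    (mdifferentiableAt_end_apply ha (sectionDiffAt_extend v))
    (mdifferentiableAt_end_apply hb (sectionDiffAt_extend v))

theorem endDiffAt_lie {a b : ∀ x, E x →L[ℂ] E x} {x : X} (ha : EndDiffAt F a x)
    (hb : EndDiffAt F b x) : EndDiffAt F (fun y => ⁅a y, b y⁆) x :=
  endDiffAt_sub (endDiffAt_mul ha hb) (endDiffAt_mul hb ha)

namespace UnitaryConnection

variable (A : UnitaryConnection F E)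

/-- In a trivialization, a connection is the sum of the derivative and of a linear map. -/
theorem exists_toFun_eq_mvfderiv_add (x₀ : X) (v : TangentSpace 𝓘(ℝ, ℂ) x₀) :
    ∃ θ : E x₀ →L[ℝ] E x₀, ∀ σ : ∀ x, E x, SectionDiffAt F σ x₀ →
      A.toFun σ x₀ v = mvfderiv 𝓘(ℝ, ℂ) (fun y => toFiber F x₀ y (σ y)) x₀ v + θ (σ x₀) := by
  have : FiniteDimensional ℝ F := FiniteDimensional.complexToReal F
  have : ContMDiffVectorBundle 1 F E 𝓘(ℝ, ℂ) := .of_le (n := ∞) (by simp)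
  let T (σ : ∀ x, E x) : E x₀ :=
    A.toFun σ x₀ v - mvfderiv 𝓘(ℝ, ℂ) (fun y => toFiber F x₀ y (σ y)) x₀ v
  have hT : TensorialAt 𝓘(ℝ, ℂ) F T x₀ :=
    { smul := fun {f σ} hf hσ => by
        have h1 := A.isCovariantDerivativeOnUniv.leibniz hσ hf
        have h2 := mvfderiv_smul hf (mdifferentiableAt_section_iff_toFiber.1 hσ)
        have h3 : (fun y => toFiber F x₀ y ((f • σ) y)) = f • fun y => toFiber F x₀ y (σ y) := by
          funext y
          exact map_smul (toFiber F x₀ y) (f y) (σ y)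
        simp only [T]
        rw [h1, h3, h2]
        simp only [add_apply, smul_apply, ContinuousLinearMap.smulRight_apply, toFiber_self,
          smul_sub]
        abel
      add := fun {σ τ} hσ hτ => by
        have h1 := A.isCovariantDerivativeOnUniv.add hσ hτ
        have h2 := mvfderiv_add (mdifferentiableAt_section_iff_toFiber.1 hσ)
          (mdifferentiableAt_section_iff_toFiber.1 hτ)
        have h3 : (fun y => toFiber F x₀ y ((σ + τ) y)) =
            (fun y => toFiber F x₀ y (σ y)) + fun y => toFiber F x₀ y (τ y) := by
          funext y
          exact map_add (toFiber F x₀ y) (σ y) (τ y)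
        simp only [T]
        rw [h1, h3, h2]
        simp only [add_apply]
        abel }
  refine ⟨TensorialAt.mkHom T x₀ hT, fun σ hσ => ?_⟩
  rw [TensorialAt.mkHom_apply hT hσ]
  simp

theorem toFun_congr {σ τ : ∀ x, E x} {x : X} (hσ : SectionDiffAt F σ x) (hτ : SectionDiffAt F τ x)
    (h : ∀ᶠ y in 𝓝 x, σ y = τ y) : A.toFun σ x = A.toFun τ x :=
  A.isCovariantDerivativeOnUniv.congr_of_eventuallyEq hσ hτ univ_mem h

theorem endCov_apply_eq {a : ∀ x, E x →L[ℂ] E x} {x : X} (ha : EndDiffAt F a x)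
    (v : TangentSpace 𝓘(ℝ, ℂ) x) (e : E x) : A.endCov a x v e =
      A.toFun (fun y => a y (FiberBundle.extend F e y)) x v -
        a x (A.toFun (FiberBundle.extend F e) x v) := by
  have h := A.endCov_apply ha (sectionDiffAt_extend e) v
  rwa [FiberBundle.extend_apply_self] at h

theorem endCov_mul {a b : ∀ x, E x →L[ℂ] E x} {x : X} (ha : EndDiffAt F a x)
    (hb : EndDiffAt F b x) (v : TangentSpace 𝓘(ℝ, ℂ) x) :
    A.endCov (fun y => a y * b y) x v = A.endCov a x v * b x + a x * A.endCov b x v := by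
  ext e
  have hs := sectionDiffAt_extend (F := F) e
  have h1 := A.endCov_apply ha (mdifferentiableAt_end_apply hb hs) v
  rw [A.endCov_apply_eq (endDiffAt_mul ha hb), add_apply, mul_apply_eq_comp, mul_apply_eq_comp,
    mul_apply_eq_comp, A.endCov_apply_eq hb, map_sub]
  rw [FiberBundle.extend_apply_self] at h1
  rw [h1]
  simp only [mul_apply_eq_comp]
  abel

theorem endCov_zero (x : X) (v : TangentSpace 𝓘(ℝ, ℂ) x) :
    A.endCov (fun _ => 0) x v = 0 := by
  have h0 : A.toFun 0 x = 0 := A.isCovariantDerivativeOnUniv.zero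
  have hz : (fun y => (0 : E y)) = 0 := rfl
  have hd : EndDiffAt F (fun y => (0 : E y →L[ℂ] E y)) x :=
    endDiffAt_of_extend fun v => mdifferentiableAt_zeroSection ..
  ext e
  rw [A.endCov_apply_eq hd]
  simp [hz, h0]

/-- The trace of an endomorphism of `E` in terms of its components in a trivialization. -/
theorem re_endTrace_eq_sum [∀ x, FiniteDimensional ℂ (E x)] (a : ∀ x, E x →L[ℂ] E x) {x₀ y : X}
    (hy : y ∈ (trivializationAt F E x₀).baseSet) {ι : Type*} [Fintype ι]
    (b : Module.Basis ι ℝ (E x₀)) :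
    (endTrace (a y)).re =
      1 / 2 * ∑ j, b.coord j (toFiber F x₀ y (a y (FiberBundle.extend F (b j) y))) := by
  classical
  have h1 := trace_restrictScalars_eq_two_mul_re (a y : E y →ₗ[ℂ] E y)
  have h2 : (a y : E y →ₗ[ℂ] E y).restrictScalars ℝ =
      (ofFiber (E := E) F x₀ y : E x₀ →ₗ[ℝ] E y) ∘ₗ ((toFiber (E := E) F x₀ y : E y →ₗ[ℝ] E x₀) ∘ₗ
        (a y : E y →ₗ[ℂ] E y).restrictScalars ℝ) := by
    ext v
    exact (ofFiber_toFiber hy _).symm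
  rw [h2, LinearMap.trace_comp_comm', LinearMap.trace_eq_matrix_trace ℝ b] at h1
  rw [endTrace, eq_comm, one_div, inv_mul_eq_iff_eq_mul₀ two_ne_zero, ← h1]
  simp only [Matrix.trace, Matrix.diag, LinearMap.toMatrix_apply]
  refine Finset.sum_congr rfl fun j _ => ?_
  rw [← ofFiber_eq_extend hy]
  rfl

/-- Smoothness of `a` is used only in the form that `a` maps sections which are smooth at a point to
such sections, which is evidently stable under composition. -/
theorem contMDiff_re_endTrace [∀ x, FiniteDimensional ℂ (E x)] {a : ∀ x, E x →L[ℂ] E x}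
    (ha : ∀ (x : X) (σ : ∀ y, E y),
      ContMDiffAt 𝓘(ℝ, ℂ) (𝓘(ℝ, ℂ).prod 𝓘(ℝ, F)) ∞ (fun y => TotalSpace.mk' F y (σ y)) x →
      ContMDiffAt 𝓘(ℝ, ℂ) (𝓘(ℝ, ℂ).prod 𝓘(ℝ, F)) ∞ (fun y => TotalSpace.mk' F y (a y (σ y))) x) :
    ContMDiff 𝓘(ℝ, ℂ) 𝓘(ℝ, ℝ) ∞ fun y => (endTrace (a y)).re := by
  intro x₀
  have : FiniteDimensional ℝ (E x₀) := FiniteDimensional.complexToReal _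
  have hl : ∀ᶠ y in 𝓝 x₀, (endTrace (a y)).re = 1 / 2 * ∑ j, (Module.finBasis ℝ (E x₀)).coord j
      (toFiber F x₀ y (a y (FiberBundle.extend F (Module.finBasis ℝ (E x₀) j) y))) := by
    filter_upwards [eventually_mem_baseSet (F := F) (E := E) x₀] with y hy
    exact re_endTrace_eq_sum a hy _
  refine ContMDiffAt.congr_of_eventuallyEq ?_ hl
  refine contMDiffAt_const.mul (contMDiffAt_finsetSum fun j _ => ?_)
  exact (LinearMap.toContinuousLinearMap
    ((Module.finBasis ℝ (E x₀)).coord j)).contMDiff.contMDiffAt.comp x₀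
    (contMDiffAt_section_iff_toFiber.1 (ha x₀ _ (FiberBundle.contMDiffAt_extend ..)))

/-- The derivative of the trace of `a` is the trace of `∇a`: in a trivialization the connection acts
on endomorphisms as the sum of the derivative and of a commutator, which has trace zero. -/
theorem mvfderiv_re_endTrace [∀ x, FiniteDimensional ℂ (E x)] {a : ∀ x, E x →L[ℂ] E x} {x₀ : X}
    (ha : EndDiffAt F a x₀) :
    MDifferentiableAt 𝓘(ℝ, ℂ) 𝓘(ℝ, ℝ) (fun y => (endTrace (a y)).re) x₀ ∧
    ∀ v, mvfderiv 𝓘(ℝ, ℂ) (fun y => (endTrace (a y)).re) x₀ v =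
      (endTrace (A.endCov a x₀ v)).re := by
  have : FiniteDimensional ℝ (E x₀) := FiniteDimensional.complexToReal _
  set b := Module.finBasis ℝ (E x₀) with hb
  let c (j) : E x₀ →L[ℝ] ℝ := LinearMap.toContinuousLinearMap (b.coord j)
  let s (j) (y : X) : E x₀ := toFiber F x₀ y (a y (FiberBundle.extend F (b j) y))
  have hs (j) : MDifferentiableAt 𝓘(ℝ, ℂ) 𝓘(ℝ, E x₀) (s j) x₀ :=
    mdifferentiableAt_section_iff_toFiber.1
      (mdifferentiableAt_end_apply ha (sectionDiffAt_extend (b j)))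
  have hl : (fun y => (endTrace (a y)).re) =ᶠ[𝓝 x₀] fun y => ∑ j, ((1 / 2 : ℝ) • c j) (s j y) := by
    filter_upwards [eventually_mem_baseSet (F := F) (E := E) x₀] with y hy
    rw [re_endTrace_eq_sum a hy b, Finset.mul_sum]
    rfl
  obtain ⟨h1, h2⟩ := mdifferentiableAt_sum_clm (fun j => (1 / 2 : ℝ) • c j) hs
  refine ⟨h1.congr_of_eventuallyEq hl, fun v => ?_⟩
  have h3 : mvfderiv 𝓘(ℝ, ℂ) (fun y => (endTrace (a y)).re) x₀ v =
      mvfderiv 𝓘(ℝ, ℂ) (fun y => ∑ j, ((1 / 2 : ℝ) • c j) (s j y)) x₀ v :=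
    congrArg (fun L : TangentSpace 𝓘(ℝ, ℂ) x₀ →L[ℝ] ℝ => L v) hl.mfderiv_eq
  rw [h3, h2]
  obtain ⟨θ, hθ⟩ := A.exists_toFun_eq_mvfderiv_add x₀ v
  -- in the trivialization, `∇a` is the sum of the derivative of `a` and of the commutator `[θ, a]`
  have h4 (j) : mvfderiv 𝓘(ℝ, ℂ) (s j) x₀ v =
      A.endCov a x₀ v (b j) - (θ (a x₀ (b j)) - a x₀ (θ (b j))) := by
    have h5 := hθ _ (mdifferentiableAt_end_apply ha (sectionDiffAt_extend (b j)))
    have h6 := hθ _ (sectionDiffAt_extend (b j))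
    have h7 : (fun y => toFiber F x₀ y (FiberBundle.extend F (b j) y)) =ᶠ[𝓝 x₀] fun _ => b j := by
      filter_upwards [eventually_mem_baseSet (F := F) (E := E) x₀] with y hy
      exact toFiber_extend hy _
    have h8 : mvfderiv 𝓘(ℝ, ℂ) (fun y => toFiber F x₀ y (FiberBundle.extend F (b j) y)) x₀ v =
        0 := by
      have h9 : mvfderiv 𝓘(ℝ, ℂ) (fun _ : X => b j) x₀ v = 0 := by rw [mvfderiv_const]; rfl
      rw [← h9]
      exact congrArg (fun L : TangentSpace 𝓘(ℝ, ℂ) x₀ →L[ℝ] E x₀ => L v) h7.mfderiv_eq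
    rw [h8, zero_add, FiberBundle.extend_apply_self] at h6
    rw [FiberBundle.extend_apply_self] at h5
    rw [A.endCov_apply_eq ha, h5, h6]
    simp only [s]
    abel
  have h5 (L : E x₀ →ₗ[ℝ] E x₀) : ∑ j, c j (L (b j)) = LinearMap.trace ℝ (E x₀) L := by
    rw [LinearMap.trace_eq_matrix_trace ℝ b]
    simp only [Matrix.trace, Matrix.diag, LinearMap.toMatrix_apply]
    rfl
  have h6 := trace_restrictScalars_eq_two_mul_re (A.endCov a x₀ v : E x₀ →ₗ[ℂ] E x₀)
  let α : E x₀ →ₗ[ℝ] E x₀ := (a x₀ : E x₀ →ₗ[ℂ] E x₀).restrictScalars ℝ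
  let τ : E x₀ →ₗ[ℝ] E x₀ := θ
  have h7 := h5 ((A.endCov a x₀ v : E x₀ →ₗ[ℂ] E x₀).restrictScalars ℝ)
  have h8 : ∑ j, c j (θ (a x₀ (b j))) = LinearMap.trace ℝ (E x₀) (τ * α) := h5 (τ * α)
  have h9 : ∑ j, c j (a x₀ (θ (b j))) = LinearMap.trace ℝ (E x₀) (α * τ) := h5 (α * τ)
  rw [LinearMap.trace_mul_comm] at h9
  have h10 : ∑ j, c j (A.endCov a x₀ v (b j)) = 2 * (endTrace (A.endCov a x₀ v)).re := h7.trans h6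
  simp only [h4, smul_apply, map_sub, smul_eq_mul, ← Finset.mul_sum, Finset.sum_sub_distrib]
  rw [h8, h9, h10]
  ring

end UnitaryConnection

end Connection

end HiggsBundle

/-! ### Hermitian sections and continuity of norms -/

namespace HiggsBundle

open Topology Filter

section GramMatrix

theorem continuousAt_trace_gram {X n : Type*} [TopologicalSpace X] [Fintype n] [DecidableEq n]
    {G N : X → Matrix n n ℝ} {x : X} (hG : ContinuousAt G x) (hN : ContinuousAt N x)
    (hdet : (G x).det ≠ 0) :
    ContinuousAt (fun y => 1 / 2 * ((G y)⁻¹ * N y * ((G y)⁻¹ * (N y).transpose)).trace) x := by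
  have h1 : ContinuousAt (Inv.inv : Matrix n n ℝ → _) (G x) := by
    refine continuousAt_matrix_inv _ ?_
    rw [Ring.inverse_eq_inv']
    exact continuousAt_inv₀ hdet
  have h2 : ContinuousAt (fun y => (G y)⁻¹) x := h1.comp hG
  have h3 : Continuous fun p : Matrix n n ℝ × Matrix n n ℝ =>
      p.1 * p.2 * (p.1 * p.2.transpose) :=
    (continuous_fst.matrix_mul continuous_snd).matrix_mul
      (continuous_fst.matrix_mul continuous_snd.matrix_transpose)
  have h4 : Continuous fun p : Matrix n n ℝ × Matrix n n ℝ =>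
      1 / 2 * (p.1 * p.2 * (p.1 * p.2.transpose)).trace :=
    continuous_const.mul h3.matrix_trace
  exact ContinuousAt.comp (f := fun y => ((G y)⁻¹, N y)) h4.continuousAt (h2.prodMk hN)

/-- A complex linear map which is symmetric for the real part of the Hermitian inner product is
symmetric. -/
theorem isSymmetric_of_real {V : Type*} [NormedAddCommGroup V] [InnerProductSpace ℂ V]
    {a : V →L[ℂ] V}
    (h : ∀ v w, inner ℝ (a v) w = inner ℝ v (a w)) :
    (a : V →ₗ[ℂ] V).IsSymmetric := by
  intro v w
  have hre (v w : V) : (inner ℂ (a v) w).re = (inner ℂ v (a w)).re := h v w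
  apply Complex.ext
  · exact hre v w
  · have h1 := hre v (Complex.I • w)
    rw [map_smul, inner_smul_right, inner_smul_right] at h1
    simpa using h1

variable {V : Type*} [NormedAddCommGroup V] [InnerProductSpace ℂ V] [FiniteDimensional ℂ V]

/-- The square norm of an endomorphism in terms of inner products of the vectors of a basis, which
need not be orthonormal. -/
theorem endNormSq_eq_trace_gram {ι : Type*} [Fintype ι] [DecidableEq ι] (b : Module.Basis ι ℝ V)
    (ψ : V →L[ℂ] V) {N : Matrix ι ι ℝ} (hN : ∀ i j, N i j = inner ℝ (b i) (ψ (b j))) :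
    endNormSq ψ = 1 / 2 *
      ((Matrix.gram ℝ b)⁻¹ * N * ((Matrix.gram ℝ b)⁻¹ * N.transpose)).trace := by
  have hG : IsUnit (Matrix.gram ℝ b).det :=
    (Matrix.det_gram_ne_zero_iff_linearIndependent.2 b.linearIndependent).isUnit
  have key (a : V →ₗ[ℝ] V) (M : Matrix ι ι ℝ) (hM : ∀ i j, M i j = inner ℝ (b i) (a (b j))) :
      LinearMap.toMatrix b b a = (Matrix.gram ℝ b)⁻¹ * M := by
    have h : Matrix.gram ℝ b * LinearMap.toMatrix b b a = M := by
      ext i j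
      rw [hM, Matrix.mul_apply]
      conv_rhs => rw [← b.sum_repr (a (b j)), inner_sum]
      refine Finset.sum_congr rfl fun k _ => ?_
      rw [real_inner_smul_right, LinearMap.toMatrix_apply, Matrix.gram_apply, mul_comm]
    rw [← h, Matrix.nonsing_inv_mul_cancel_left _ _ hG]
  have h1 := key ((ψ : V →ₗ[ℂ] V).restrictScalars ℝ) N hN
  have h2 := key ((endAdjoint ψ : V →ₗ[ℂ] V).restrictScalars ℝ) N.transpose fun i j => by
    rw [Matrix.transpose_apply, hN]
    change _ = (inner ℂ (b i) (endAdjoint ψ (b j))).re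
    rw [inner_endAdjoint_right, real_inner_comm]
    rfl
  rw [← h1, ← h2, ← LinearMap.toMatrix_mul, ← LinearMap.trace_eq_matrix_trace]
  have h3 := trace_restrictScalars_eq_two_mul_re ((ψ * endAdjoint ψ : V →L[ℂ] V) : V →ₗ[ℂ] V)
  rw [endNormSq, endInner, endTrace]
  change _ = 1 / 2 * LinearMap.trace ℝ V
    (((ψ * endAdjoint ψ : V →L[ℂ] V) : V →ₗ[ℂ] V).restrictScalars ℝ)
  rw [h3]
  ring

end GramMatrix

section Continuity

variable {X : Type*} [TopologicalSpace X] [ChartedSpace ℂ X] [IsManifold 𝓘(ℂ) ω X]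
  {F : Type*} [NormedAddCommGroup F] [NormedSpace ℂ F]
  {E : X → Type*} [TopologicalSpace (TotalSpace F E)]
  [∀ x, NormedAddCommGroup (E x)] [∀ x, InnerProductSpace ℂ (E x)] [∀ x, FiniteDimensional ℂ (E x)]
  [FiberBundle F E] [VectorBundle ℂ F E] [VectorBundle ℝ F E]
  [FiniteDimensional ℂ F] [ContMDiffVectorBundle ∞ F E 𝓘(ℝ, ℂ)]
  [IsContMDiffRiemannianBundle 𝓘(ℝ, ℂ) ∞ F E]

set_option linter.unusedSectionVars false

open UnitaryConnection

theorem continuousAt_inner_section {σ τ : ∀ x, E x} {x : X} (hσ : SectionDiffAt F σ x)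
    (hτ : SectionDiffAt F τ x) : ContinuousAt (fun y => inner ℝ (σ y) (τ y)) x := by
  have : IsContMDiffRiemannianBundle 𝓘(ℝ, ℂ) 1 F E := .of_le (n := ∞) (by simp)
  exact (hσ.inner_bundle hτ).continuousAt

theorem continuousAt_endNormSq {ψ : ∀ x, E x →L[ℂ] E x} {x₀ : X} (hψ : EndDiffAt F ψ x₀) :
    ContinuousAt (fun y => endNormSq (ψ y)) x₀ := by
  classical
  have : FiniteDimensional ℝ (E x₀) := FiniteDimensional.complexToReal _
  set b := Module.finBasis ℝ (E x₀) with hb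
  let s (i) (y : X) : E y := FiberBundle.extend F (b i) y
  have hs (i) : SectionDiffAt F (s i) x₀ := sectionDiffAt_extend (b i)
  let G (y : X) : Matrix _ _ ℝ := Matrix.gram ℝ fun i => s i y
  let N (y : X) : Matrix _ _ ℝ := Matrix.of fun i j => inner ℝ (s i y) (ψ y (s j y))
  have hl : (fun y => endNormSq (ψ y)) =ᶠ[𝓝 x₀] fun y =>
      1 / 2 * ((G y)⁻¹ * N y * ((G y)⁻¹ * (N y).transpose)).trace := by
    filter_upwards [eventually_mem_baseSet (F := F) (E := E) x₀] with y hy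
    let T : E x₀ ≃ₗ[ℝ] E y := LinearEquiv.ofLinearMap (ofFiber (E := E) F x₀ y : E x₀ →ₗ[ℝ] E y)
      (toFiber (E := E) F x₀ y : E y →ₗ[ℝ] E x₀)
      (LinearMap.ext fun v => ofFiber_toFiber hy v) (LinearMap.ext fun v => toFiber_ofFiber hy v)
    have hT : ⇑(b.map T) = fun i => s i y := by
      funext i
      exact ofFiber_eq_extend hy (b i)
    have h := endNormSq_eq_trace_gram (b.map T) (ψ y) (N := N y) fun i j => by rw [hT]; rfl
    rw [h, hT]
  refine ContinuousAt.congr ?_ hl.symm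
  have hG : ContinuousAt G x₀ := continuousAt_pi.2 fun i => continuousAt_pi.2 fun j =>
    continuousAt_inner_section (hs i) (hs j)
  have hN : ContinuousAt N x₀ := continuousAt_pi.2 fun i => continuousAt_pi.2 fun j =>
    continuousAt_inner_section (hs i) (mdifferentiableAt_end_apply hψ (hs j))
  have hdet : (G x₀).det ≠ 0 := by
    have : (fun i => s i x₀) = b := by
      funext i
      exact FiberBundle.extend_apply_self ..
    simp only [G]
    rw [this]
    exact Matrix.det_gram_ne_zero_iff_linearIndependent.2 b.linearIndependent
  exact continuousAt_trace_gram hG hN hdet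

/-- A unitary connection preserves the Hermitian endomorphisms. -/
theorem UnitaryConnection.isSymmetric_endCov (A : UnitaryConnection F E) {a : ∀ x, E x →L[ℂ] E x}
    {x : X} (ha : EndDiffAt F a x) (hs : ∀ y, (a y : E y →ₗ[ℂ] E y).IsSymmetric)
    (v : TangentSpace 𝓘(ℝ, ℂ) x) : (A.endCov a x v : E x →ₗ[ℂ] E x).IsSymmetric := by
  have : FiniteDimensional ℝ F := FiniteDimensional.complexToReal F
  have : ContMDiffVectorBundle 1 F E 𝓘(ℝ, ℂ) := .of_le (n := ∞) (by simp)
  have : IsContMDiffRiemannianBundle 𝓘(ℝ, ℂ) 1 F E := .of_le (n := ∞) (by simp)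
  refine isSymmetric_of_real fun e e' => ?_
  set σ := fun y => FiberBundle.extend F e y
  set τ := fun y => FiberBundle.extend F e' y
  have hσ : SectionDiffAt F σ x := sectionDiffAt_extend e
  have hτ : SectionDiffAt F τ x := sectionDiffAt_extend e'
  have hr (y : X) (u w : E y) : inner ℝ (a y u) w = inner ℝ u (a y w) :=
    congrArg Complex.re (hs y u w)
  have h1 := A.isMetricCompatible.mvfderiv_inner_eq (FiberBundle.extend ℂ v)
    (mdifferentiableAt_end_apply ha hσ) hτ
  have h2 := A.isMetricCompatible.mvfderiv_inner_eq (FiberBundle.extend ℂ v) hσ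
    (mdifferentiableAt_end_apply ha hτ)
  have h3 : (fun y => inner ℝ (a y (σ y)) (τ y)) = fun y => inner ℝ (σ y) (a y (τ y)) :=
    funext fun y => hr y _ _
  rw [h3, h2] at h1
  have h4 : σ x = e := FiberBundle.extend_apply_self ..
  have h5 : τ x = e' := FiberBundle.extend_apply_self ..
  rw [A.endCov_apply_eq ha, A.endCov_apply_eq ha, inner_sub_left, inner_sub_right]
  beta_reduce at h1
  rw [h4, h5, FiberBundle.extend_apply_self, hr, ← hr x e] at h1
  rw [hr, ← hr x e]
  linarith

end Continuity

end HiggsBundle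

/-! ### Covariant derivatives along vector fields -/

namespace HiggsBundle

open Topology Filter

section CovariantDerivatives

variable {X : Type*} [TopologicalSpace X] [ChartedSpace ℂ X] [IsManifold 𝓘(ℂ) ω X]
  {F : Type*} [NormedAddCommGroup F] [NormedSpace ℂ F]
  {E : X → Type*} [TopologicalSpace (TotalSpace F E)]
  [∀ x, NormedAddCommGroup (E x)] [∀ x, InnerProductSpace ℂ (E x)]
  [FiberBundle F E] [VectorBundle ℂ F E] [VectorBundle ℝ F E]
  [FiniteDimensional ℂ F] [ContMDiffVectorBundle ∞ F E 𝓘(ℝ, ℂ)]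
  [IsContMDiffRiemannianBundle 𝓘(ℝ, ℂ) ∞ F E]

set_option linter.unusedSectionVars false

open UnitaryConnection

/-- The vector field `V` is differentiable at `x`. -/
abbrev FieldDiffAt (V : ∀ x : X, TangentSpace 𝓘(ℝ, ℂ) x) (x : X) : Prop :=
  MDifferentiableAt 𝓘(ℝ, ℂ) (𝓘(ℝ, ℂ).prod 𝓘(ℝ, ℂ))
    (fun y => (⟨y, V y⟩ : TotalSpace ℂ (TangentSpace 𝓘(ℝ, ℂ) : X → Type _))) x

theorem fieldDiffAt_extend {x : X} (v : TangentSpace 𝓘(ℝ, ℂ) x) :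
    FieldDiffAt (FiberBundle.extend ℂ v) x :=
  FiberBundle.mdifferentiableAt_extend ..

/-- The local sections which are constant in a trivialization extend to global smooth sections. -/
theorem exists_contMDiff_eventuallyEq_extend [T2Space X] {x₀ : X} (e : E x₀) :
    ∃ σ : ∀ x, E x, ContMDiff 𝓘(ℝ, ℂ) (𝓘(ℝ, ℂ).prod 𝓘(ℝ, F)) ∞ (fun y => TotalSpace.mk' F y (σ y)) ∧
      ∀ᶠ y in 𝓝 x₀, σ y = FiberBundle.extend F e y := by
  obtain ⟨f, -, hf⟩ := (SmoothBumpFunction.nhds_basis_tsupport (I := 𝓘(ℝ, ℂ)) x₀).mem_iff.1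
    (eventually_mem_baseSet (F := F) (E := E) x₀)
  refine ⟨(f : X → ℝ) • (FiberBundle.extend F e : ∀ x, E x), ?_, ?_⟩
  · refine ContMDiffOn.smul_section_of_tsupport f.contMDiff.contMDiffOn
      (trivializationAt F E x₀).open_baseSet hf ?_
    rw [(trivializationAt F E x₀).contMDiffOn_section_baseSet_iff]
    refine (contMDiffOn_const (c := (trivializationAt F E x₀ ⟨x₀, e⟩).2)).congr fun y hy => ?_
    simp [FiberBundle.extend, hy]
  · filter_upwards [f.eventuallyEq_one] with y hy
    simp [hy]

theorem contMDiffAt_end_apply {a : ∀ x, E x →L[ℂ] E x} {x : X} {n : ℕ∞ω}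
    (ha : ContMDiffAt 𝓘(ℝ, ℂ) (𝓘(ℝ, ℂ).prod 𝓘(ℝ, F →L[ℝ] F)) n (endSection F a) x)
    {σ : ∀ x, E x}
    (hσ : ContMDiffAt 𝓘(ℝ, ℂ) (𝓘(ℝ, ℂ).prod 𝓘(ℝ, F)) n (fun y => TotalSpace.mk' F y (σ y)) x) :
    ContMDiffAt 𝓘(ℝ, ℂ) (𝓘(ℝ, ℂ).prod 𝓘(ℝ, F)) n (fun y => TotalSpace.mk' F y (a y (σ y))) x :=
  ContMDiffAt.clm_bundle_apply (F₁ := F) (F₂ := F) (b := fun y => y) (x := x)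
    (ϕ := fun y => (a y).restrictScalars ℝ) (v := σ) ha hσ

/-- The values of a smooth form with values in `Hom(E, E)` on a differentiable vector field. -/
theorem endDiffAt_oneForm_apply {Φ : ∀ x : X, TangentSpace 𝓘(ℝ, ℂ) x →L[ℝ] (E x →L[ℂ] E x)}
    {x : X} (hΦ : MDifferentiableAt 𝓘(ℝ, ℂ) (𝓘(ℝ, ℂ).prod 𝓘(ℝ, ℂ →L[ℝ] F →L[ℝ] F))
      (endOneFormSection F Φ) x) {V : ∀ x : X, TangentSpace 𝓘(ℝ, ℂ) x} (hV : FieldDiffAt V x) :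
    EndDiffAt F (fun y => Φ y (V y)) x :=
  MDifferentiableAt.clm_bundle_apply (F₁ := ℂ) (F₂ := F →L[ℝ] F) (b := fun y => y) (x := x)
    (E₁ := (TangentSpace 𝓘(ℝ, ℂ) : X → Type _)) (E₂ := fun x => E x →L[ℝ] E x)
    (ϕ := fun y => (ContinuousLinearMap.restrictScalarsL ℂ (E y) (E y) ℝ ℝ).comp (Φ y)) (v := V)
    hΦ hV

namespace UnitaryConnection

variable (A : UnitaryConnection F E)

theorem sectionDiffAt_toFun {σ : ∀ x, E x}
    (hσ : ContMDiff 𝓘(ℝ, ℂ) (𝓘(ℝ, ℂ).prod 𝓘(ℝ, F)) ∞ (fun y => TotalSpace.mk' F y (σ y)))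
    {V : ∀ x : X, TangentSpace 𝓘(ℝ, ℂ) x} {x : X} (hV : FieldDiffAt V x) :
    SectionDiffAt F (fun y => A.toFun σ y (V y)) x := by
  have h := A.smooth.contMDiff.contMDiff (σ := σ) hσ.contMDiffOn
  have h1 : MDifferentiableAt 𝓘(ℝ, ℂ) (𝓘(ℝ, ℂ).prod 𝓘(ℝ, ℂ →L[ℝ] F))
      (fun y => (⟨y, A.toFun σ y⟩ : TotalSpace (ℂ →L[ℝ] F)
        (fun x : X => TangentSpace 𝓘(ℝ, ℂ) x →L[ℝ] E x))) x :=
    (h.contMDiffAt univ_mem).mdifferentiableAt (by simp)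
  exact MDifferentiableAt.clm_bundle_apply (F₁ := ℂ) (F₂ := F) (b := fun y => y) (x := x)
    (E₁ := (TangentSpace 𝓘(ℝ, ℂ) : X → Type _)) (E₂ := E) (ϕ := fun y => A.toFun σ y) (v := V) h1 hV

/-- The covariant derivative of a smooth section of `Hom(E, E)` along a differentiable vector field
is differentiable. -/
theorem endDiffAt_endCov [T2Space X] {a : ∀ x, E x →L[ℂ] E x}
    (ha : ContMDiff 𝓘(ℝ, ℂ) (𝓘(ℝ, ℂ).prod 𝓘(ℝ, F →L[ℝ] F)) ∞ (endSection F a))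
    {V : ∀ x : X, TangentSpace 𝓘(ℝ, ℂ) x} {x : X} (hV : FieldDiffAt V x) :
    EndDiffAt F (fun y => A.endCov a y (V y)) x := by
  have hd (y : X) : EndDiffAt F a y := (ha y).mdifferentiableAt (by simp)
  refine endDiffAt_of_extend fun e => ?_
  obtain ⟨σ, hσ, hσe⟩ := exists_contMDiff_eventuallyEq_extend (F := F) e
  have h1 := A.sectionDiffAt_toFun (fun y => contMDiffAt_end_apply (ha y) (hσ y)) hV
  have h2 := mdifferentiableAt_end_apply (hd x) (A.sectionDiffAt_toFun hσ hV)
  refine (mdifferentiableAt_sub_section h1 h2).congr_of_eventuallyEq ?_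
  filter_upwards [hσe] with y hy
  rw [← hy, A.endCov_apply (hd y) ((hσ y).mdifferentiableAt (by simp))]
  rfl

end UnitaryConnection

end CovariantDerivatives

end HiggsBundle

/-! ### Pointwise norms of forms -/

namespace HiggsBundle

open Topology Filter InnerProductSpace Laplacian

section PointwiseNorms

variable {X : Type*} [TopologicalSpace X] [ChartedSpace ℂ X] [IsManifold 𝓘(ℂ) ω X]
  {F : Type*} [NormedAddCommGroup F] [NormedSpace ℂ F]
  {E : X → Type*} [TopologicalSpace (TotalSpace F E)]
  [∀ x, NormedAddCommGroup (E x)] [∀ x, InnerProductSpace ℂ (E x)] [∀ x, FiniteDimensional ℂ (E x)]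
  [FiberBundle F E] [VectorBundle ℂ F E] [VectorBundle ℝ F E]
  [FiniteDimensional ℂ F] [ContMDiffVectorBundle ∞ F E 𝓘(ℝ, ℂ)]
  [IsContMDiffRiemannianBundle 𝓘(ℝ, ℂ) ∞ F E] (g : ConformalMetric X)

set_option linter.unusedSectionVars false

open UnitaryConnection

/-- The coordinate vector fields `∂/∂x` and `∂/∂y` of the chart preferred at `x` are exchanged
by `J`. -/
theorem eventually_extend_eq (x : X) : ∀ᶠ y in 𝓝 x,
    FiberBundle.extend ℂ (tangentOf x Complex.I) y =
      tangentJ y (FiberBundle.extend ℂ (tangentOf x 1) y) ∧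
    tangentJ y (FiberBundle.extend ℂ (tangentOf x Complex.I) y) =
      -FiberBundle.extend ℂ (tangentOf x 1) y := by
  filter_upwards [(chartAt ℂ x).open_source.mem_nhds (mem_chart_source ℂ x)] with y hy
  rw [extend_tangentOf hy, extend_tangentOf hy, tangentJ_tangentOf, tangentJ_tangentOf]
  constructor
  · congr 1
    ring
  · change Complex.I * (chartDeriv (chartAt ℂ x) y * Complex.I) = -(chartDeriv (chartAt ℂ x) y * 1)
    linear_combination chartDeriv (chartAt ℂ x) y * Complex.I_mul_I

/-- The norm of a form can be computed in any basis `v`, `Jv` of the tangent space. -/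
theorem formNormSq_eq (L : ∀ x : X, TangentSpace 𝓘(ℝ, ℂ) x →ₗ[ℝ] (E x →L[ℂ] E x)) (x : X) {c : ℂ}
    (hc : c ≠ 0) : formNormSq g (fun x v => L x v) x = (‖c‖ ^ 2 * g.factor x)⁻¹ *
      (endNormSq (L x (tangentOf x c)) + endNormSq (L x (tangentJ x (tangentOf x c)))) := by
  rw [tangentJ_tangentOf, map_tangentOf, map_tangentOf]
  have h1 : (Complex.I * c).re • L x (tangentOne x) +
      (Complex.I * c).im • L x (tangentJ x (tangentOne x)) =
      c.re • L x (tangentJ x (tangentOne x)) - c.im • L x (tangentOne x) := by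
    simp only [Complex.mul_re, Complex.mul_im, Complex.I_re, Complex.I_im, zero_mul, one_mul,
      zero_sub, zero_add, neg_smul]
    abel
  rw [h1, endNormSq_rotate, formNormSq, ConformalMetric.factor]
  have h2 : ‖c‖ ≠ 0 := norm_ne_zero_iff.2 hc
  rw [mul_inv, mul_assoc, mul_left_comm, inv_mul_cancel_left₀ (pow_ne_zero 2 h2)]

theorem continuous_formNormSq (L : ∀ x : X, TangentSpace 𝓘(ℝ, ℂ) x →ₗ[ℝ] (E x →L[ℂ] E x))
    (hL : ∀ (x : X) (v : TangentSpace 𝓘(ℝ, ℂ) x),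
      EndDiffAt F (fun y => L y (FiberBundle.extend ℂ v y)) x) :
    Continuous (formNormSq g fun x v => L x v) := by
  refine continuous_iff_continuousAt.2 fun x => ?_
  have he := chart_mem_atlas ℂ x
  have hx := mem_chart_source ℂ x
  have hne : ‖chartDeriv (chartAt ℂ x) x‖ ^ 2 * g.factor x ≠ 0 :=
    mul_ne_zero (pow_ne_zero 2 (norm_ne_zero_iff.2 (chartDeriv_ne_zero he hx))) (g.factor_pos x).ne'
  refine (((g.continuousAt_factor_mul he hx).inv₀ hne).mul
    ((continuousAt_endNormSq (hL x (tangentOf x 1))).add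
      (continuousAt_endNormSq (hL x (tangentOf x Complex.I))))).congr ?_
  filter_upwards [(chartAt ℂ x).open_source.mem_nhds hx, eventually_extend_eq x] with y hy hJ
  simp only [Pi.mul_apply, Pi.add_apply, Pi.inv_apply]
  rw [hJ.1, extend_tangentOf hy, mul_one, formNormSq_eq g L y (chartDeriv_ne_zero he hy)]

/-- For a form of type `(1, 0)`, both vectors of an orthonormal basis contribute equally. -/
theorem two_mul_typeOneZeroNormSq {α : ∀ x : X, TangentSpace 𝓘(ℝ, ℂ) x → (E x →L[ℂ] E x)}
    (hα : ∀ x v, α x (tangentJ x v) = Complex.I • α x v) (x : X) :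
    2 * typeOneZeroNormSq g α x = formNormSq g α x := by
  rw [formNormSq, typeOneZeroNormSq, hα, endNormSq_I_smul]
  ring

end PointwiseNorms

/-! ### The pointwise identity -/

section Bochner

variable {X : Type*} [TopologicalSpace X] [ChartedSpace ℂ X] [IsManifold 𝓘(ℂ) ω X] [T2Space X]
  {F : Type*} [NormedAddCommGroup F] [NormedSpace ℂ F]
  {E : X → Type*} [TopologicalSpace (TotalSpace F E)]
  [∀ x, NormedAddCommGroup (E x)] [∀ x, InnerProductSpace ℂ (E x)] [∀ x, FiniteDimensional ℂ (E x)]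
  [FiberBundle F E] [VectorBundle ℂ F E] [VectorBundle ℝ F E]
  [FiniteDimensional ℂ F] [ContMDiffVectorBundle ∞ F E 𝓘(ℝ, ℂ)]
  [IsContMDiffRiemannianBundle 𝓘(ℝ, ℂ) ∞ F E] (g : ConformalMetric X) (A : UnitaryConnection F E)

set_option linter.unusedSectionVars false

open UnitaryConnection

theorem UnitaryConnection.endCov_congr {a b : ∀ x, E x →L[ℂ] E x} {x : X} (ha : EndDiffAt F a x)
    (hab : ∀ᶠ y in 𝓝 x, a y = b y) : A.endCov a x = A.endCov b x := by
  have hb : EndDiffAt F b x := ha.congr_of_eventuallyEq <| by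
    filter_upwards [hab] with y hy
    simp only [endSection, hy]
  ext v e
  have hs := sectionDiffAt_extend (F := F) e
  rw [A.endCov_apply_eq ha, A.endCov_apply_eq hb, hab.self_of_nhds,
    A.toFun_congr (mdifferentiableAt_end_apply ha hs) (mdifferentiableAt_end_apply hb hs)]
  filter_upwards [hab] with y hy
  rw [hy]

theorem endDiffAt_neg {a : ∀ x, E x →L[ℂ] E x} {x : X} (ha : EndDiffAt F a x) :
    EndDiffAt F (fun y => -a y) x :=
  endDiffAt_of_extend fun e =>
    mdifferentiableAt_neg_section (mdifferentiableAt_end_apply ha (sectionDiffAt_extend e))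

theorem UnitaryConnection.endCov_neg {a : ∀ x, E x →L[ℂ] E x} {x : X} (ha : EndDiffAt F a x)
    (v : TangentSpace 𝓘(ℝ, ℂ) x) : A.endCov (fun y => -a y) x v = -A.endCov a x v := by
  have hs (e : E x) := sectionDiffAt_extend (F := F) e
  ext e
  have h1 := A.isCovariantDerivativeOnUniv.smul_const (-1)
    (mdifferentiableAt_end_apply ha (hs e))
  have h2 : (fun y => (-a y) (FiberBundle.extend F e y)) =
      (-1 : ℝ) • fun y => a y (FiberBundle.extend F e y) := by
    funext y
    simp
  rw [neg_apply, A.endCov_apply_eq (endDiffAt_neg ha), A.endCov_apply_eq ha, h2, h1]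
  simp
  abel

/-- The connection Laplacian in the coordinate fields `V = ∂/∂x` and `W = ∂/∂y` of a chart, which
commute. -/
theorem laplacian_eq {γ : ∀ x, E x →L[ℂ] E x}
    (hγ : ContMDiff 𝓘(ℝ, ℂ) (𝓘(ℝ, ℂ).prod 𝓘(ℝ, F →L[ℝ] F)) ∞ (endSection F γ)) (x : X) :
    laplacian g A γ x = -((g.factor x)⁻¹ •
      (A.endCov (fun y => A.endCov γ y (FiberBundle.extend ℂ (tangentOf x 1) y)) x (tangentOf x 1) +
        A.endCov (fun y => A.endCov γ y (FiberBundle.extend ℂ (tangentOf x Complex.I) y)) x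
          (tangentOf x Complex.I))) := by
  have hJ : tangentJ x (tangentOne x) = tangentOf x Complex.I := by
    change Complex.I * 1 = Complex.I
    rw [mul_one]
  have hd (c : ℂ) := A.endDiffAt_endCov hγ (fieldDiffAt_extend (tangentOf x c))
  rw [laplacian, starTwo, hJ, extCov, mlieBracket_extend, ConformalMetric.factor]
  change -(_ • (A.endCov _ x (tangentOf x 1) - A.endCov _ x (tangentOf x Complex.I) - _)) = _
  have h1 : A.endCov (fun y => A.endCov γ y (FiberBundle.extend ℂ (tangentOf x 1) y)) x =
      A.endCov (fun y => starOne (A.dForm γ) y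
        (FiberBundle.extend ℂ (tangentOf x Complex.I) y)) x := by
    refine A.endCov_congr (hd 1) ?_
    filter_upwards [eventually_extend_eq x] with y hy
    rw [starOne, dForm, hy.2, map_neg, neg_neg]
  have h2 : -A.endCov (fun y => A.endCov γ y (FiberBundle.extend ℂ (tangentOf x Complex.I) y)) x
        (tangentOf x Complex.I) =
      A.endCov (fun y => starOne (A.dForm γ) y
        (FiberBundle.extend ℂ (tangentOf x 1) y)) x (tangentOf x Complex.I) := by
    rw [← A.endCov_neg (hd Complex.I)]
    refine LinearMap.congr_fun (A.endCov_congr (endDiffAt_neg (hd Complex.I)) ?_) _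
    filter_upwards [eventually_extend_eq x] with y hy
    rw [starOne, dForm, hy.1]
  have h3 : starOne (A.dForm γ) x 0 = 0 := by
    rw [starOne, dForm, map_zero, map_zero, neg_zero]
  rw [h3, sub_zero, h1, ← sub_neg_eq_add, h2]
  rfl

/-- The second derivative of `|γ|²` along a coordinate vector field `V` is
`2 Tr (∇_V ∇_V γ γ) + 2 Tr ((∇_V γ)²)`. -/
theorem fderiv_fderiv_re_endTrace_mul_self {γ : ∀ x, E x →L[ℂ] E x}
    (hγ : ContMDiff 𝓘(ℝ, ℂ) (𝓘(ℝ, ℂ).prod 𝓘(ℝ, F →L[ℝ] F)) ∞ (endSection F γ)) (x : X) (c : ℂ) :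
    fderiv ℝ (fun z => fderiv ℝ ((fun y => (endTrace (γ y * γ y)).re) ∘ (chartAt ℂ x).symm) z c)
      (chartAt ℂ x x) c =
    2 * (endTrace (A.endCov (fun y => A.endCov γ y (FiberBundle.extend ℂ (tangentOf x c) y)) x
      (tangentOf x c) * γ x)).re +
    2 * (endTrace (A.endCov γ x (tangentOf x c) * A.endCov γ x (tangentOf x c))).re := by
  have he := chart_mem_atlas ℂ x
  have hx := mem_chart_source ℂ x
  have hd (y : X) : EndDiffAt F γ y := (hγ y).mdifferentiableAt (by simp)
  set V := fun y => FiberBundle.extend ℂ (tangentOf x c) y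
  have hV : EndDiffAt F (fun y => A.endCov γ y (V y)) x :=
    A.endDiffAt_endCov hγ (fieldDiffAt_extend (tangentOf x c))
  -- a derivative in the chart is a derivative along `V`
  have key {h : X → ℝ} {y : X} (hy : y ∈ (chartAt ℂ x).source)
      (hh : MDifferentiableAt 𝓘(ℝ, ℂ) 𝓘(ℝ, ℝ) h y) :
      fderiv ℝ (h ∘ (chartAt ℂ x).symm) (chartAt ℂ x y) c = mvfderiv 𝓘(ℝ, ℂ) h y (V y) := by
    rw [← mfderiv_tangentOf he hy hh]
    simp only [V]
    rw [extend_tangentOf hy]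
    rfl
  have h1 (y : X) : mvfderiv 𝓘(ℝ, ℂ) (fun y => (endTrace (γ y * γ y)).re) y (V y) =
      2 * (endTrace (A.endCov γ y (V y) * γ y)).re := by
    rw [(A.mvfderiv_re_endTrace (endDiffAt_mul (hd y) (hd y))).2, A.endCov_mul (hd y) (hd y),
      endTrace_add, endTrace_mul_comm (γ y), Complex.add_re, two_mul]
  have h2 : (fun z => fderiv ℝ ((fun y => (endTrace (γ y * γ y)).re) ∘ (chartAt ℂ x).symm) z c)
      =ᶠ[𝓝 (chartAt ℂ x x)]
      fun z => (2 : ℝ) • ((fun y => (endTrace (A.endCov γ y (V y) * γ y)).re) ∘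
        (chartAt ℂ x).symm) z := by
    filter_upwards [(chartAt ℂ x).open_target.mem_nhds (mem_chart_target ℂ x)] with z hz
    have h3 := key ((chartAt ℂ x).map_target hz)
      (A.mvfderiv_re_endTrace (endDiffAt_mul (hd _) (hd _))).1
    rw [(chartAt ℂ x).right_inv hz] at h3
    rw [h3, h1]
    rfl
  have h4 := A.mvfderiv_re_endTrace (endDiffAt_mul hV (hd x))
  have h5 : DifferentiableAt ℝ ((fun y => (endTrace (A.endCov γ y (V y) * γ y)).re) ∘
      (chartAt ℂ x).symm) (chartAt ℂ x x) := by
    have h6 := mdifferentiableAt_atlas_symm (I := 𝓘(ℝ, ℂ)) he (mem_chart_target ℂ x)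
    have h7 := h4.1
    rw [← (chartAt ℂ x).left_inv hx] at h7
    exact mdifferentiableAt_iff_differentiableAt.1 (h7.comp _ h6)
  have hVx : V x = tangentOf x c := FiberBundle.extend_apply_self ..
  rw [h2.fderiv_eq, fderiv_fun_const_smul h5, smul_apply, key hx h4.1, h4.2,
    A.endCov_mul hV (hd x), endTrace_add, Complex.add_re, hVx, smul_eq_mul, mul_add]

end Bochner

end HiggsBundle

/-! ### The energy identity -/

namespace HiggsBundle

open Topology Filter InnerProductSpace Laplacian

section Energy

variable {X : Type*} [TopologicalSpace X] [ChartedSpace ℂ X] [IsManifold 𝓘(ℂ) ω X] [T2Space X]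
  {F : Type*} [NormedAddCommGroup F] [NormedSpace ℂ F]
  {E : X → Type*} [TopologicalSpace (TotalSpace F E)]
  [∀ x, NormedAddCommGroup (E x)] [∀ x, InnerProductSpace ℂ (E x)] [∀ x, FiniteDimensional ℂ (E x)]
  [FiberBundle F E] [VectorBundle ℂ F E] [VectorBundle ℝ F E]
  [FiniteDimensional ℂ F] [ContMDiffVectorBundle ∞ F E 𝓘(ℝ, ℂ)]
  [IsContMDiffRiemannianBundle 𝓘(ℝ, ℂ) ∞ F E] (g : ConformalMetric X) (A : UnitaryConnection F E)
  {Φ : ∀ x : X, TangentSpace 𝓘(ℝ, ℂ) x →L[ℝ] (E x →L[ℂ] E x)} {γ : ∀ x, E x →L[ℂ] E x}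

set_option linter.unusedSectionVars false

open UnitaryConnection

theorem endTrace_mul_self_eq {V : Type*} [NormedAddCommGroup V] [InnerProductSpace ℂ V]
    [FiniteDimensional ℂ V] {a : V →L[ℂ] V} (ha : (a : V →ₗ[ℂ] V).IsSymmetric) :
    endTrace (a * a) = endNormSq a := by
  rw [← endInner_self, endInner, endAdjoint_eq_self ha]

theorem endTrace_mul_eq_re {V : Type*} [NormedAddCommGroup V] [InnerProductSpace ℂ V]
    [FiniteDimensional ℂ V] {a b : V →L[ℂ] V} (ha : (a : V →ₗ[ℂ] V).IsSymmetric)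
    (hb : (b : V →ₗ[ℂ] V).IsSymmetric) : endTrace (a * b) = (endTrace (a * b)).re := by
  have h := endTrace_endAdjoint (a * b)
  rw [endAdjoint_mul, endAdjoint_eq_self ha, endAdjoint_eq_self hb, endTrace_mul_comm] at h
  exact (Complex.conj_eq_iff_re.1 h.symm).symm

/-- The function `|γ|²` for a Hermitian section `γ`. -/
def normSqFunction (γ : ∀ x, E x →L[ℂ] E x) (y : X) : ℝ := (endTrace (γ y * γ y)).re

theorem contMDiff_normSqFunction (hγ : IsHermitianSection F γ) :
    ContMDiff 𝓘(ℝ, ℂ) 𝓘(ℝ, ℝ) ∞ (normSqFunction γ) :=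
  contMDiff_re_endTrace (F := F) fun x _ hσ =>
    contMDiffAt_end_apply (hγ.smooth x) (contMDiffAt_end_apply (hγ.smooth x) hσ)

/-- Bochner's formula `⟨Δ_A γ, γ⟩ = |d_A γ|² - ½ Δ|γ|²` for a Hermitian section `γ`. -/
theorem endInner_laplacian (hγ : IsHermitianSection F γ) (x : X) :
    endInner (laplacian g A γ x) (γ x) =
      ((formNormSq g (A.dForm γ) x - 1 / 2 * g.surfaceLaplacian (normSqFunction γ) x : ℝ) : ℂ) := by
  have hd (y : X) : EndDiffAt F γ y := (hγ.smooth y).mdifferentiableAt (by simp)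
  have hs (y : X) (v) := A.isSymmetric_endCov (hd y) hγ.hermitian v
  set D : ℂ → (E x →L[ℂ] E x) := fun c =>
    A.endCov (fun y => A.endCov γ y (FiberBundle.extend ℂ (tangentOf x c) y)) x (tangentOf x c)
    with hD
  have hDs (c : ℂ) : (D c : E x →ₗ[ℂ] E x).IsSymmetric :=
    A.isSymmetric_endCov (A.endDiffAt_endCov hγ.smooth (fieldDiffAt_extend (tangentOf x c)))
      (fun y => hs y _) _
  have h1 (c : ℂ) := fderiv_fderiv_re_endTrace_mul_self A hγ.smooth x c
  have h2 : Δ (normSqFunction γ ∘ (chartAt ℂ x).symm) (chartAt ℂ x x) =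
      2 * (endTrace (D 1 * γ x)).re + 2 * endNormSq (A.endCov γ x (tangentOf x 1)) +
      (2 * (endTrace (D Complex.I * γ x)).re +
        2 * endNormSq (A.endCov γ x (tangentOf x Complex.I))) := by
    rw [laplacian_eq_fderiv_fderiv ((contDiffAt_comp_chart_symm (chart_mem_atlas ℂ x)
      (contMDiff_normSqFunction hγ) (mem_chart_target ℂ x)).of_le two_le_infty)]
    have h3 := h1 1
    have h4 := h1 Complex.I
    rw [endTrace_mul_self_eq (hs x _), Complex.ofReal_re] at h3 h4
    exact congrArg₂ (· + ·) h3 h4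
  have h3 : formNormSq g (A.dForm γ) x = (g.factor x)⁻¹ *
      (endNormSq (A.endCov γ x (tangentOf x 1)) +
        endNormSq (A.endCov γ x (tangentOf x Complex.I))) := by
    have h4 := formNormSq_eq g (fun x => A.endCov γ x) x (one_ne_zero (α := ℂ))
    rw [tangentJ_tangentOf, mul_one, norm_one, one_pow, one_mul] at h4
    exact h4
  have h4 : laplacian g A γ x = -((g.factor x)⁻¹ • (D 1 + D Complex.I)) :=
    laplacian_eq g A hγ.smooth x
  have h5 (r : ℝ) (a : E x →L[ℂ] E x) : -(r • a) * γ x = (-r : ℂ) • (a * γ x) := by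
    rw [← neg_smul, smul_mul_assoc, ← Complex.ofReal_neg]
    rfl
  rw [ConformalMetric.surfaceLaplacian, h2, h3, endInner, endAdjoint_eq_self (hγ.hermitian x), h4,
    h5, endTrace_smul, add_mul, endTrace_add, endTrace_mul_eq_re (hDs 1) (hγ.hermitian x),
    endTrace_mul_eq_re (hDs Complex.I) (hγ.hermitian x)]
  simp only [Complex.ofReal_re]
  push_cast
  ring

theorem endInner_starTwo_higgsTerm (hΦ : IsHiggsField F Φ) (hγ : IsHermitianSection F γ) (t : ℝ)
    (x : X) :
    endInner ((Complex.I * (t : ℂ) ^ 2) • starTwo g (higgsTerm (fun x v => Φ x v) γ) x) (γ x) =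
      -((4 * t ^ 2 * typeOneZeroNormSq g (formBracket (fun x v => Φ x v) γ) x : ℝ) : ℂ) := by
  set φ := Φ x (tangentOne x) with hφ
  have hJ : Φ x (tangentJ x (tangentOne x)) = Complex.I • φ := hΦ.type_one_zero x _
  have hγx := endAdjoint_eq_self (hγ.hermitian x)
  have h1 : higgsTerm (fun x v => Φ x v) γ x (tangentOne x) (tangentJ x (tangentOne x)) =
      (2 * Complex.I) • (⁅endAdjoint φ, ⁅φ, γ x⁆⁆ + ⁅φ, ⁅endAdjoint φ, γ x⁆⁆) := by
    change (⁅endAdjoint φ, ⁅Φ x (tangentJ x (tangentOne x)), γ x⁆⁆ -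
        ⁅endAdjoint (Φ x (tangentJ x (tangentOne x))), ⁅φ, γ x⁆⁆) -
      (⁅φ, ⁅endAdjoint (Φ x (tangentJ x (tangentOne x))), γ x⁆⁆ -
        ⁅Φ x (tangentJ x (tangentOne x)), ⁅endAdjoint φ, γ x⁆⁆) = _
    rw [hJ, endAdjoint_I_smul]
    simp only [Ring.lie_def, smul_mul_assoc, mul_smul_comm, smul_sub, smul_add, mul_smul, neg_mul,
      mul_neg, mul_sub, sub_mul, two_smul]
    abel
  have h2 (r : ℝ) (c : ℂ) (a : E x →L[ℂ] E x) :
      (Complex.I * (t : ℂ) ^ 2) • r • (c • a) * γ x = (Complex.I * t ^ 2 * r * c) • (a * γ x) := by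
    have : r • (c • a) = (r : ℂ) • (c • a) := rfl
    rw [this, smul_smul, smul_smul, smul_mul_assoc]
  rw [endInner, hγx, starTwo, h1, smul_mul_assoc, ← smul_mul_assoc, h2, endTrace_smul,
    endTrace_lie_lie hγx, typeOneZeroNormSq]
  change _ = -((4 * t ^ 2 * (_ * endNormSq ⁅φ, γ x⁆) : ℝ) : ℂ)
  push_cast
  linear_combination 4 * (t : ℂ) ^ 2 * (g.inner x (tangentOne x) (tangentOne x) : ℂ)⁻¹ *
    (endNormSq ⁅φ, γ x⁆ : ℂ) * Complex.I_mul_I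

/-- The pointwise form of the identity: the two sides differ by the Laplacian of `|γ|² / 2`. -/
theorem endInner_linearization (hΦ : IsHiggsField F Φ) (hγ : IsHermitianSection F γ) (t : ℝ)
    (x : X) :
    endInner (linearization g A (fun x v => Φ x v) t γ x) (γ x) =
      ((formNormSq g (A.dForm γ) x +
        4 * t ^ 2 * typeOneZeroNormSq g (formBracket (fun x v => Φ x v) γ) x -
        1 / 2 * g.surfaceLaplacian (normSqFunction γ) x : ℝ) : ℂ) := by
  have h (a b c : E x →L[ℂ] E x) : endInner (a - b) c = endInner a c - endInner b c := by
    rw [endInner, sub_mul, endTrace_sub]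
    rfl
  rw [linearization, h, endInner_laplacian g A hγ, endInner_starTwo_higgsTerm g hΦ hγ]
  push_cast
  ring

theorem continuous_formNormSq_dForm (hγ : IsHermitianSection F γ) :
    Continuous (formNormSq g (A.dForm γ)) :=
  continuous_formNormSq g (fun x => A.endCov γ x) fun _ v =>
    A.endDiffAt_endCov hγ.smooth (fieldDiffAt_extend v)

/-- The form `[Φ, γ]`, as a family of linear maps. -/
def bracketLinear (Φ : ∀ x : X, TangentSpace 𝓘(ℝ, ℂ) x →L[ℝ] (E x →L[ℂ] E x))
    (γ : ∀ x, E x →L[ℂ] E x) (x : X) : TangentSpace 𝓘(ℝ, ℂ) x →ₗ[ℝ] (E x →L[ℂ] E x) where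
  toFun v := ⁅Φ x v, γ x⁆
  map_add' v w := by
    simp only [map_add, Ring.lie_def, add_mul, mul_add]
    abel
  map_smul' r v := by
    rw [map_smul, Ring.lie_def, Ring.lie_def, smul_mul_assoc, mul_smul_comm, ← smul_sub]
    rfl

theorem continuous_formNormSq_bracket (hΦ : IsHiggsField F Φ) (hγ : IsHermitianSection F γ) :
    Continuous (formNormSq g (formBracket (fun x v => Φ x v) γ)) :=
  continuous_formNormSq g (bracketLinear Φ γ) fun x v =>
    endDiffAt_lie (endDiffAt_oneForm_apply ((hΦ.smooth x).mdifferentiableAt (by simp))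
      (fieldDiffAt_extend v)) ((hγ.smooth x).mdifferentiableAt (by simp))

theorem two_mul_typeOneZeroNormSq_bracket (hΦ : IsHiggsField F Φ) (x : X) :
    2 * typeOneZeroNormSq g (formBracket (fun x v => Φ x v) γ) x =
      formNormSq g (formBracket (fun x v => Φ x v) γ) x := by
  refine two_mul_typeOneZeroNormSq g (fun x v => ?_) x
  rw [formBracket, formBracket, hΦ.type_one_zero, Ring.lie_def, Ring.lie_def, smul_mul_assoc,
    mul_smul_comm, smul_sub]

theorem formNormSq_nonneg (α : ∀ x : X, TangentSpace 𝓘(ℝ, ℂ) x → (E x →L[ℂ] E x)) (x : X) :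
    0 ≤ formNormSq g α x :=
  mul_nonneg (inv_nonneg.2 (g.factor_pos x).le)
    (add_nonneg (endNormSq_nonneg _) (endNormSq_nonneg _))

/-- A linear form of norm zero vanishes. -/
theorem eq_zero_of_formNormSq_eq_zero
    {L : ∀ x : X, TangentSpace 𝓘(ℝ, ℂ) x →ₗ[ℝ] (E x →L[ℂ] E x)} {x : X}
    (h : formNormSq g (fun x v => L x v) x = 0) (v : TangentSpace 𝓘(ℝ, ℂ) x) : L x v = 0 := by
  have h1 := (mul_eq_zero.1 h).resolve_left (inv_ne_zero (g.factor_pos x).ne')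
  rw [add_eq_zero_iff_of_nonneg (endNormSq_nonneg _) (endNormSq_nonneg _)] at h1
  have h2 := map_tangentOf (L x) (v : ℂ)
  beta_reduce at h1
  rw [endNormSq_eq_zero h1.1, endNormSq_eq_zero h1.2, smul_zero, smul_zero, add_zero] at h2
  exact h2

/-- If `∇γ` and `[Φ, γ]` vanish, then so does `[Φ*, γ] = -[Φ, γ]*`, and every term of the operator
vanishes. -/
theorem linearization_eq_zero (hγ : IsHermitianSection F γ) (t : ℝ) (h1 : A.dForm γ = 0)
    (h2 : formBracket (fun x v => Φ x v) γ = 0) (x : X) :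
    linearization g A (fun x v => Φ x v) t γ x = 0 := by
  have hz : starOne (A.dForm γ) = fun _ _ => 0 := by
    funext y v
    rw [h1]
    exact neg_zero
  have h3 : formBracket (adjointForm fun x v => Φ x v) γ = 0 := by
    funext y v
    have h4 : ⁅Φ y v, γ y⁆ = 0 := congrFun (congrFun h2 y) v
    have h5 := endAdjoint_lie (φ := Φ y v) (endAdjoint_eq_self (hγ.hermitian y))
    have h6 : endAdjoint (0 : E y →L[ℂ] E y) = 0 :=
      ((eq_endAdjoint_iff _ _).2 fun v w => by simp).symm
    rw [h4, h6, eq_comm, neg_eq_zero] at h5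
    exact h5
  have h4 : laplacian g A γ x = 0 := by
    rw [laplacian, starTwo, hz, extCov, A.endCov_zero, A.endCov_zero]
    simp
  have h5 : higgsTerm (fun x v => Φ x v) γ = 0 := by
    funext y v w
    change wedgeBracket (adjointForm fun x v => Φ x v) (formBracket (fun x v => Φ x v) γ) y v w -
      wedgeBracket (fun x v => Φ x v) (formBracket (adjointForm fun x v => Φ x v) γ) y v w = 0
    rw [h2, h3]
    simp [wedgeBracket, Ring.lie_def]
  rw [linearization, h4, h5, starTwo]
  simp

end Energy

end HiggsBundle

end

theorem mainTheorem10
    {X : Type*} [TopologicalSpace X] [ChartedSpace ℂ X] [IsManifold 𝓘(ℂ) ω X]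
    [CompactSpace X] [T2Space X] [MeasurableSpace X] [BorelSpace X]
    {F : Type*} [NormedAddCommGroup F] [NormedSpace ℂ F] [FiniteDimensional ℂ F]
    {E : X → Type*} [TopologicalSpace (TotalSpace F E)]
    [∀ x, NormedAddCommGroup (E x)] [∀ x, InnerProductSpace ℂ (E x)]
    [∀ x, FiniteDimensional ℂ (E x)]
    [FiberBundle F E] [VectorBundle ℂ F E] [VectorBundle ℝ F E]
    [ContMDiffVectorBundle ∞ F E 𝓘(ℝ, ℂ)] [IsContMDiffRiemannianBundle 𝓘(ℝ, ℂ) ∞ F E]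
    (g : HiggsBundle.ConformalMetric X) (A : HiggsBundle.UnitaryConnection F E)
    (Φ : ∀ x : X, TangentSpace 𝓘(ℝ, ℂ) x →L[ℝ] (E x →L[ℂ] E x))
    (hΦ : HiggsBundle.IsHiggsField F Φ) (t : ℝ) (ht : 0 < t)
    (γ : ∀ x, E x →L[ℂ] E x) (hγ : HiggsBundle.IsHermitianSection F γ) :
    -- the integrands are integrable
    Integrable (fun x => HiggsBundle.endInner
      (HiggsBundle.linearization g A (fun x v => Φ x v) t γ x) (γ x)) g.area ∧
    Integrable (HiggsBundle.formNormSq g (A.dForm γ)) g.area ∧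
    Integrable (HiggsBundle.typeOneZeroNormSq g
      (HiggsBundle.formBracket (fun x v => Φ x v) γ)) g.area ∧
    -- the identity
    (t : ℂ) ^ (-2 : ℤ) * HiggsBundle.l2Inner g
        (HiggsBundle.linearization g A (fun x v => Φ x v) t γ) γ =
      ((t ^ (-2 : ℤ) * HiggsBundle.l2NormSq g (A.dForm γ)
        + 4 * HiggsBundle.l2NormSqOneZero g
          (HiggsBundle.formBracket (fun x v => Φ x v) γ) : ℝ) : ℂ) ∧
    4 * HiggsBundle.l2NormSqOneZero g (HiggsBundle.formBracket (fun x v => Φ x v) γ) =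
      2 * HiggsBundle.l2NormSq g (HiggsBundle.formBracket (fun x v => Φ x v) γ) ∧
    -- positivity
    0 ≤ t ^ (-2 : ℤ) * HiggsBundle.l2NormSq g (A.dForm γ)
        + 4 * HiggsBundle.l2NormSqOneZero g
          (HiggsBundle.formBracket (fun x v => Φ x v) γ) ∧
    -- the kernel
    (HiggsBundle.linearization g A (fun x v => Φ x v) t γ = 0 ↔
      A.dForm γ = 0 ∧ HiggsBundle.formBracket (fun x v => Φ x v) γ = 0) := by
  set ψ := HiggsBundle.formBracket (fun x v => Φ x v) γ
  set d := HiggsBundle.formNormSq g (A.dForm γ) with hd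
  set n := HiggsBundle.typeOneZeroNormSq g ψ with hn
  set l := g.surfaceLaplacian (HiggsBundle.normSqFunction γ)
  have hint {f : X → ℝ} (hf : Continuous f) : Integrable f g.area :=
    hf.integrable_of_hasCompactSupport (HasCompactSupport.of_compactSpace _)
  have hsm := HiggsBundle.contMDiff_normSqFunction hγ
  have h2n (x : X) : 2 * n x = HiggsBundle.formNormSq g ψ x :=
    HiggsBundle.two_mul_typeOneZeroNormSq_bracket g hΦ x
  have hdc : Continuous d := HiggsBundle.continuous_formNormSq_dForm g A hγ
  have hnc : Continuous n := by
    have h := (HiggsBundle.continuous_formNormSq_bracket g hΦ hγ).const_mul (1 / 2)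
    refine h.congr fun x => ?_
    rw [← h2n x]
    ring
  have hlc : Continuous l := g.continuous_surfaceLaplacian hsm
  have hd0 (x : X) : 0 ≤ d x := HiggsBundle.formNormSq_nonneg g _ x
  have hn0 (x : X) : 0 ≤ n x := by
    have := HiggsBundle.formNormSq_nonneg g ψ x
    linarith [h2n x]
  have hpt (x : X) : HiggsBundle.endInner
      (HiggsBundle.linearization g A (fun x v => Φ x v) t γ x) (γ x) =
        ((d x + 4 * t ^ 2 * n x - 1 / 2 * l x : ℝ) : ℂ) :=
    HiggsBundle.endInner_linearization g A hΦ hγ t x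
  have hint_n : Integrable (fun x => 4 * t ^ 2 * n x) g.area := hint (hnc.const_mul _)
  have hint_l : Integrable (fun x => 1 / 2 * l x) g.area := hint (hlc.const_mul _)
  have hint_dn : Integrable (fun x => d x + 4 * t ^ 2 * n x) g.area := (hint hdc).add hint_n
  have htot : HiggsBundle.l2Inner g (HiggsBundle.linearization g A (fun x v => Φ x v) t γ) γ =
      ((∫ x, d x ∂g.area + 4 * t ^ 2 * ∫ x, n x ∂g.area : ℝ) : ℂ) := by
    rw [HiggsBundle.l2Inner, integral_congr_ae (Filter.Eventually.of_forall hpt),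
      integral_complex_ofReal, integral_sub hint_dn hint_l, integral_add (hint hdc) hint_n,
      integral_const_mul, integral_const_mul, g.integral_surfaceLaplacian hsm, mul_zero, sub_zero]
  have ht0 : t ≠ 0 := ht.ne'
  have hnonneg : 0 ≤ t ^ (-2 : ℤ) * HiggsBundle.l2NormSq g (A.dForm γ) +
      4 * HiggsBundle.l2NormSqOneZero g ψ :=
    add_nonneg (mul_nonneg (zpow_nonneg ht.le _) (integral_nonneg hd0))
      (mul_nonneg (by norm_num) (integral_nonneg hn0))
  refine ⟨?_, hint hdc, hint hnc, ?_, ?_, hnonneg, ?_⟩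
  · refine Integrable.congr ?_ (Filter.Eventually.of_forall fun x => (hpt x).symm)
    exact (hint_dn.sub hint_l).ofReal
  · rw [htot, HiggsBundle.l2NormSq, HiggsBundle.l2NormSqOneZero, ← hd, ← hn]
    have htc : (t : ℂ) ≠ 0 := Complex.ofReal_ne_zero.2 ht0
    push_cast
    rw [zpow_neg, zpow_ofNat]
    field_simp
  · have h : HiggsBundle.l2NormSq g ψ = 2 * HiggsBundle.l2NormSqOneZero g ψ := by
      rw [HiggsBundle.l2NormSq, HiggsBundle.l2NormSqOneZero, ← integral_const_mul]
      exact integral_congr_ae (Filter.Eventually.of_forall fun x => (h2n x).symm)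
    rw [h]
    ring
  constructor
  · intro h
    -- the integral of a sum of two nonnegative continuous functions vanishes
    have h1 : ∫ x, (d x + 4 * t ^ 2 * n x) ∂g.area = 0 := by
      have h2 : HiggsBundle.l2Inner g
          (HiggsBundle.linearization g A (fun x v => Φ x v) t γ) γ = 0 := by
        simp [h, HiggsBundle.l2Inner, HiggsBundle.endInner, HiggsBundle.endTrace]
      rw [htot] at h2
      rw [integral_add (hint hdc) hint_n, integral_const_mul]
      exact_mod_cast h2
    have hc : Continuous fun x => d x + 4 * t ^ 2 * n x := hdc.add (hnc.const_mul _)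
    have hp (x : X) : 0 ≤ d x + 4 * t ^ 2 * n x :=
      add_nonneg (hd0 x) (mul_nonneg (by positivity) (hn0 x))
    have h3 := (hc.ae_eq_iff_eq g.area continuous_zero).1
      ((integral_eq_zero_iff_of_nonneg hp (hint hc)).1 h1)
    have h4 (x : X) : d x = 0 ∧ n x = 0 := by
      have h5 : d x + 4 * t ^ 2 * n x = 0 := congrFun h3 x
      have h6 : 0 < 4 * t ^ 2 := by positivity
      have h7 := mul_nonneg h6.le (hn0 x)
      refine ⟨by linarith [hd0 x], ?_⟩
      exact (mul_eq_zero.1 (by linarith [hd0 x] : 4 * t ^ 2 * n x = 0)).resolve_left h6.ne'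
    constructor
    · funext x v
      exact HiggsBundle.eq_zero_of_formNormSq_eq_zero g (L := fun x => A.endCov γ x) (h4 x).1 v
    · funext x v
      refine HiggsBundle.eq_zero_of_formNormSq_eq_zero g (L := HiggsBundle.bracketLinear Φ γ) ?_ v
      exact (h2n x).symm.trans (by rw [(h4 x).2, mul_zero])
  · rintro ⟨h1, h2⟩
    funext x
    exact HiggsBundle.linearization_eq_zero g A hγ t h1 h2 x
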